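/- \textbf{Theorem.} Let $n\ge 1$ and $1\le p\le\infty$. Let $S_p^1(\mathbb{R}^n)$ be the space of (classes of a.e. equal) real functions $u\in L_p(\mathbb{R}^n)$ whose weak derivatives $\frac{\partial^k u}{\partial x_{i_1}\cdots\partial x_{i_k}}$, $1\le i_1<\cdots<i_k\le n$, $1\le k\le n$, all exist and lie in $L_p(\mathbb{R}^n)$, with the norm $$\|u\|_{S_p^1}=\Big(\|u\|_{L_p}^p+\sum_{k=1}^n\sum_{i_1<\cdots<i_k}\Big\|\frac{\partial^k u}{\partial x_{i_1}\cdots\partial x_{i_k}}\Big\|_{L_p}^p\Big)^{1/p}\ (p<\infty),\qquad \|u\|_{S_\infty^1}=\|u\|_{L_\infty}+\sum_{k=1}^n\sum_{i_1<\cdots<i_k}\Big\|\frac{\partial^k u}{\partial x_{i_1}\cdots\partial x_{i_k}}\Big\|_{L_\infty}.$$ For $0\le\gamma\le 1$ let $C^{0,\gamma}(\mathbb{R}^n)$ be the space of bounded continuous functions $v$ with finite norm $\|v\|_{C^{0,\gamma}}=\sup_x|v(x)|+\sup_{x\ne x'}\frac{|v(x)-v(x')|}{|x-x'|^\gamma}$.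 Then there is a constant $C=C(n,p)$ such that every $u\in S_p^1(\mathbb{R}^n)$ has a representative $u_*\in C^{0,1-1/p}(\mathbb{R}^n)$ (that is, $u_*=u$ a.e.) with the following properties. (i) $\|u_*\|_{C^{0,1-1/p}(\mathbb{R}^n)}\le C\,\|u\|_{S_p^1(\mathbb{R}^n)}$; that is, $S_p^1(\mathbb{R}^n)\hookrightarrow C^{0,1-1/p}(\mathbb{R}^n)$ is a bounded embedding. (ii) Let $x,x'\in\mathbb{R}^n$ with $x_i<x'_i$ for all $i$, let $P=\{\eta: x_i\le\eta_i\le x'_i,\ i=1,\dots,n\}$ and, for $1\le i_1<\cdots<i_k\le n$, let $P_{i_1\cdots i_k}=\{\eta\in P:\eta_l=x_l \text{ for } l\notin\{i_1,\dots,i_k\}\}$. Then each derivative $\frac{\partial^k u}{\partial x_{i_1}\cdots\partial x_{i_k}}$ has a trace on $P_{i_1\cdots i_k}$ that belongs to $L_p(P_{i_1\cdots i_k})$ (for $k=n$ this is just its restriction to $P$), and, with the integrands understood as these traces, the generalized Newton-Leibniz formula holds: $$u_*(x')-u_*(x)=\sum_{k=1}^n\ \sum_{1\le i_1<\cdots<i_k\le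 n}\ \int_{P_{i_1\cdots i_k}}\frac{\partial^k u(\eta)}{\partial x_{i_1}\cdots\partial x_{i_k}}\,d\eta_{i_1}\cdots d\eta_{i_k}.$$ Here $t\in L_p(P_{i_1\cdots i_k})$ is called the trace of a function $g$ on $P_{i_1\cdots i_k}$ if, for every finite $q\in[1,p]$: there are functions $f_m\in C^\infty(\mathbb{R}^n)$ such that $f_m\to g$ in $L_q(P)$ and, for every nonempty set $\{j_1,\dots,j_r\}$ of indices outside $\{i_1,\dots,i_k\}$, $\frac{\partial^r f_m}{\partial x_{j_1}\cdots\partial x_{j_r}}\to\frac{\partial^r g}{\partial x_{j_1}\cdots\partial x_{j_r}}$ (weak derivative) in $L_q(P)$; and for every such sequence $f_m|_{P_{i_1\cdots i_k}}\to t$ in $L_q(P_{i_1\cdots i_k})$. -/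

import Mathlib

open MeasureTheory Filter Topology
open scoped ENNReal NNReal ContDiff

noncomputable section

/-- The point of `ℝⁿ` whose `i`-th coordinate is `η i` for `i ∈ S`, and `x i` for `i ∉ S`. -/
def extendBy {n : ℕ} (x : EuclideanSpace ℝ (Fin n)) (S : Finset (Fin n)) (η : S → ℝ) :
    EuclideanSpace ℝ (Fin n) :=
  WithLp.toLp 2 (fun i => if h : i ∈ S then η ⟨i, h⟩ else x i)

/-- The `n`-rectangle `P` with bottom corner `x` and top corner `x'`. -/
def rect {n : ℕ} (x x' : EuclideanSpace ℝ (Fin n)) : Set (EuclideanSpace ℝ (Fin n)) :=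
  {η | ∀ i, x i ≤ η i ∧ η i ≤ x' i}

/-- The sub-rectangle of `P` on which `η_l = x_l` for all `l ∉ S`, described by its free
coordinates `(η_i)_{i ∈ S}`: it is the image of this set under `extendBy x S`, and it carries
Lebesgue measure in these coordinates. -/
def subRect {n : ℕ} (x x' : EuclideanSpace ℝ (Fin n)) (S : Finset (Fin n)) : Set (S → ℝ) :=
  {η | ∀ i : S, x i ≤ η i ∧ η i ≤ x' i}

/-- The classical partial derivative `∂f/∂x_i`. -/
def partialDeriv {n : ℕ} (i : Fin n) (f : EuclideanSpace ℝ (Fin n) → ℝ) :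
    EuclideanSpace ℝ (Fin n) → ℝ :=
  fun x => lineDeriv ℝ f x (EuclideanSpace.single i 1)

/-- The classical mixed partial derivative `∂ᵏf/∂x_{i_1}⋯∂x_{i_k}`, where
`S = {i_1 < ⋯ < i_k}`; it is `f` itself when `S = ∅`. -/
def mixedPartial {n : ℕ} (S : Finset (Fin n)) (f : EuclideanSpace ℝ (Fin n) → ℝ) :
    EuclideanSpace ℝ (Fin n) → ℝ :=
  (S.sort (· ≤ ·)).foldr partialDeriv f

/-- `g` is the weak mixed derivative `∂ᵏu/∂x_{i_1}⋯∂x_{i_k}` of `u` on `ℝⁿ`, where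
`S = {i_1, …, i_k}`. -/
def HasWeakMixedDeriv {n : ℕ} (S : Finset (Fin n)) (u g : EuclideanSpace ℝ (Fin n) → ℝ) : Prop :=
  LocallyIntegrable u ∧ LocallyIntegrable g ∧
    ∀ φ : EuclideanSpace ℝ (Fin n) → ℝ, ContDiff ℝ ∞ φ → HasCompactSupport φ →
      ∫ y, u y * mixedPartial S φ y = (-1) ^ S.card * ∫ y, g y * φ y

open Classical in
/-- A weak mixed derivative of `u`, unique up to null sets; `0` if there is none. -/
def weakDeriv {n : ℕ} (S : Finset (Fin n)) (u : EuclideanSpace ℝ (Fin n) → ℝ) :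
    EuclideanSpace ℝ (Fin n) → ℝ :=
  if h : ∃ g, HasWeakMixedDeriv S u g then h.choose else 0

/-- `u` belongs to `S_p^1(ℝⁿ)`: `u` and all of its mixed weak derivatives with respect to
distinct variables exist and are in `L_p(ℝⁿ)`. -/
def MemSobolevS {n : ℕ} (p : ℝ≥0∞) (u : EuclideanSpace ℝ (Fin n) → ℝ) : Prop :=
  MemLp u p ∧ ∀ S : Finset (Fin n), S.Nonempty → ∃ g, HasWeakMixedDeriv S u g ∧ MemLp g p

/-- The norm of `S_p^1(ℝⁿ)`. -/
def sobolevSNorm {n : ℕ} (p : ℝ≥0∞) (u : EuclideanSpace ℝ (Fin n) → ℝ) : ℝ≥0∞ :=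
  if p = ⊤ then
    eLpNorm u ⊤ + ∑ S : Finset (Fin n) with S.Nonempty, eLpNorm (weakDeriv S u) ⊤
  else
    (eLpNorm u p ^ p.toReal +
      ∑ S : Finset (Fin n) with S.Nonempty, eLpNorm (weakDeriv S u) p ^ p.toReal) ^ (1 / p.toReal)

/-- The norm of the Hölder space `C^{0,γ}(ℝⁿ)`: supremum norm plus Hölder seminorm. -/
def holderNorm {n : ℕ} (γ : ℝ≥0) (v : EuclideanSpace ℝ (Fin n) → ℝ) : ℝ≥0∞ :=
  (⨆ x, ‖v x‖ₑ) + eHolderNorm γ v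

/-- `v` belongs to the Hölder space `C^{0,γ}(ℝⁿ)`. -/
def MemHolderSpace {n : ℕ} (γ : ℝ≥0) (v : EuclideanSpace ℝ (Fin n) → ℝ) : Prop :=
  Continuous v ∧ holderNorm γ v < ⊤

/-- The smooth functions `f m` converge to `g` in `L_q(P)`, together with all mixed derivatives
with respect to the variables `x_l`, `l ∉ S` (those transversal to the sub-rectangle of `P` with
free coordinates in `S`). -/
def TransversalApprox {n : ℕ} (q : ℝ≥0∞) (S : Finset (Fin n))
    (x x' : EuclideanSpace ℝ (Fin n)) (f : ℕ → EuclideanSpace ℝ (Fin n) → ℝ)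
    (g : EuclideanSpace ℝ (Fin n) → ℝ) : Prop :=
  (∀ m, ContDiff ℝ ∞ (f m)) ∧
    ∀ R : Finset (Fin n), Disjoint R S →
      Tendsto (fun m => eLpNorm (mixedPartial R (f m) - weakDeriv R g) q
        (volume.restrict (rect x x'))) atTop (𝓝 0)

/-- `t ∈ L_p` is the trace of `g` on the sub-rectangle of `P` with free coordinates in `S`, i.e.
`t` is the value at `g` of the continuous extension of the restriction map `f ↦ f|_{P_S}` from
smooth functions: smooth approximations of `g` as in `TransversalApprox` exist, and for every one
of them the restrictions converge to `t`. Convergence is in `L_q` for all finite `q ∈ [1, p]`, so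
in `L_p` itself if `p < ∞`. -/
def IsTrace {n : ℕ} (p : ℝ≥0∞) (S : Finset (Fin n)) (x x' : EuclideanSpace ℝ (Fin n))
    (g : EuclideanSpace ℝ (Fin n) → ℝ) (t : (S → ℝ) → ℝ) : Prop :=
  MemLp t p (volume.restrict (subRect x x' S)) ∧
    ∀ q : ℝ≥0∞, 1 ≤ q → q ≤ p → q ≠ ⊤ →
      (∃ f, TransversalApprox q S x x' f g) ∧
      ∀ f, TransversalApprox q S x x' f g →
        Tendsto (fun m => eLpNorm (fun η => f m (extendBy x S η) - t η) q
          (volume.restrict (subRect x x' S))) atTop (𝓝 0)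

end

/-! ### Classical mixed partial derivatives of smooth functions -/

section Calculus

variable {n : ℕ} {f g : EuclideanSpace ℝ (Fin n) → ℝ}

/-! Mollification commutes with the mixed derivatives of `u`, and these converge in `L_q` on boxes
for every finite `q ≤ p`. So it suffices to have estimates for smooth `f` that differentiate each
variable at most once. Their source is one-dimensional: averaging `φ a = φ t - ∫ φ'` over `t ∈ [a,
b]` bounds `|φ a|^q` by the integrals of `|φ|^q` and `|φ'|^q`. Using this once in each coordinate
outside `S` gives `lintegral_subRect_le`: `f` on the face with free coordinates `S` is controlled by
its derivatives in variables outside `S` on the whole box.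

Three choices of `S` matter. For `S = ∅` this is a pointwise bound; it makes the mollifications
locally uniformly Cauchy, and their limit is the continuous representative. For `S = {i}`, applied
to `∂f/∂x_i` on a box with `i`-th side `h` and other sides `1`, it bounds the increment of `f` in
direction `i` by `L_1` norms over a box of volume `h`; Hölder's inequality turns this into
`h^(1-1/p)`, and changing coordinates one at a time gives the Hölder seminorm. For general `S` it
says that restriction to a face is continuous (`exists_eLpNorm_extendBy_le`), which produces the
traces (`HasTransversalDerivs.exists_isTrace`).

The Newton-Leibniz formula for smooth `f` (`newton_leibniz`) is an induction on the variables. For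
`u` it follows in the limit: pointwise convergence on the left, `L_1` convergence to the traces on
the right. -/

lemma partialDeriv_eq_fderiv (hf : ContDiff ℝ ∞ f) (i : Fin n) :
    partialDeriv i f = fun x => fderiv ℝ f x (EuclideanSpace.single i 1) := by
  funext x
  exact ((hf.differentiable (by simp)) x).lineDeriv_eq_fderiv

lemma contDiff_partialDeriv (hf : ContDiff ℝ ∞ f) (i : Fin n) :
    ContDiff ℝ ∞ (partialDeriv i f) := by
  rw [partialDeriv_eq_fderiv hf]
  exact (hf.fderiv_right (by simp)).clm_apply contDiff_const

lemma partialDeriv_comm (hf : ContDiff ℝ ∞ f) (i j : Fin n) :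
    partialDeriv i (partialDeriv j f) = partialDeriv j (partialDeriv i f) := by
  have key : ∀ (i j : Fin n) (x : EuclideanSpace ℝ (Fin n)),
      partialDeriv i (partialDeriv j f) x =
        fderiv ℝ (fderiv ℝ f) x (EuclideanSpace.single i 1) (EuclideanSpace.single j 1) := by
    intro i j x
    rw [partialDeriv_eq_fderiv (contDiff_partialDeriv hf j), partialDeriv_eq_fderiv hf]
    have h1 : DifferentiableAt ℝ (fderiv ℝ f) x :=
      (hf.fderiv_right (m := ∞) (by simp)).differentiable (by simp) x
    simp [fderiv_clm_apply h1 (differentiableAt_const _)]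
  funext x
  rw [key, key]
  have hs : IsSymmSndFDerivAt ℝ f x :=
    (hf.contDiffAt).isSymmSndFDerivAt
      (by simpa using WithTop.coe_le_coe.2 (le_top : (2 : ℕ∞) ≤ ⊤))
  exact hs _ _

lemma contDiff_foldr_partialDeriv (hf : ContDiff ℝ ∞ f) (l : List (Fin n)) :
    ContDiff ℝ ∞ (l.foldr partialDeriv f) := by
  induction l with
  | nil => exact hf
  | cons i l ih => exact contDiff_partialDeriv ih i

lemma contDiff_mixedPartial (hf : ContDiff ℝ ∞ f) (S : Finset (Fin n)) :
    ContDiff ℝ ∞ (mixedPartial S f) :=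
  contDiff_foldr_partialDeriv hf _

/-- Adjacent swaps are the symmetry of second derivatives. This frees `mixedPartial` from its sorted
order, so that inductions may add indices in any order. -/
lemma foldr_partialDeriv_perm (hf : ContDiff ℝ ∞ f) {l₁ l₂ : List (Fin n)} (h : l₁.Perm l₂) :
    l₁.foldr partialDeriv f = l₂.foldr partialDeriv f := by
  induction h with
  | nil => rfl
  | cons i _ ih => simp [ih]
  | swap i j l => exact partialDeriv_comm (contDiff_foldr_partialDeriv hf l) _ _
  | trans _ _ h₁ h₂ => exact h₁.trans h₂

@[simp] lemma mixedPartial_empty (f : EuclideanSpace ℝ (Fin n) → ℝ) : mixedPartial ∅ f = f := by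
  simp [mixedPartial]

lemma mixedPartial_insert (hf : ContDiff ℝ ∞ f) {i : Fin n} {S : Finset (Fin n)} (hi : i ∉ S) :
    mixedPartial (insert i S) f = partialDeriv i (mixedPartial S f) := by
  have : ((insert i S).sort (· ≤ ·)).Perm (i :: S.sort (· ≤ ·)) := by
    rw [List.perm_ext_iff_of_nodup (Finset.sort_nodup _ _)
      (List.nodup_cons.2 ⟨by simpa using hi, Finset.sort_nodup _ _⟩)]
    simp
  simpa [mixedPartial] using foldr_partialDeriv_perm hf this

lemma mixedPartial_singleton (hf : ContDiff ℝ ∞ f) (i : Fin n) :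
    mixedPartial {i} f = partialDeriv i f := by
  simpa using mixedPartial_insert hf (Finset.notMem_empty i)

lemma mixedPartial_mixedPartial (hf : ContDiff ℝ ∞ f) {R S : Finset (Fin n)} (h : Disjoint R S) :
    mixedPartial R (mixedPartial S f) = mixedPartial (R ∪ S) f := by
  induction R using Finset.induction_on with
  | empty => simp
  | insert i R hi ih =>
    rw [Finset.disjoint_insert_left] at h
    rw [mixedPartial_insert (contDiff_mixedPartial hf S) hi, ih h.2, Finset.insert_union,
      mixedPartial_insert hf (by simp [hi, h.1])]

lemma partialDeriv_sub (hf : ContDiff ℝ ∞ f) (hg : ContDiff ℝ ∞ g) (i : Fin n) :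
    partialDeriv i (f - g) = partialDeriv i f - partialDeriv i g := by
  have hfg : ContDiff ℝ ∞ (f - g) := hf.sub hg
  rw [partialDeriv_eq_fderiv hfg, partialDeriv_eq_fderiv hf, partialDeriv_eq_fderiv hg]
  funext x
  simp [fderiv_sub (hf.differentiable (by simp) x) (hg.differentiable (by simp) x)]

lemma mixedPartial_sub (hf : ContDiff ℝ ∞ f) (hg : ContDiff ℝ ∞ g) (S : Finset (Fin n)) :
    mixedPartial S (f - g) = mixedPartial S f - mixedPartial S g := by
  induction S using Finset.induction_on with
  | empty => simp
  | insert i S hi ih =>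
    have hfg : ContDiff ℝ ∞ (f - g) := hf.sub hg
    rw [mixedPartial_insert hfg hi, mixedPartial_insert hf hi, mixedPartial_insert hg hi,
      ih, partialDeriv_sub (contDiff_mixedPartial hf S) (contDiff_mixedPartial hg S)]

lemma hasCompactSupport_mixedPartial (hf : ContDiff ℝ ∞ f) (hc : HasCompactSupport f)
    (S : Finset (Fin n)) : HasCompactSupport (mixedPartial S f) := by
  induction S using Finset.induction_on with
  | empty => simpa
  | insert i S hi ih =>
    rw [mixedPartial_insert hf hi, partialDeriv_eq_fderiv (contDiff_mixedPartial hf S)]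
    exact ih.fderiv_apply ℝ _

lemma partialDeriv_const_smul (c : ℝ) (hf : ContDiff ℝ ∞ f) (i : Fin n) :
    partialDeriv i (fun y => c * f y) = fun y => c * partialDeriv i f y := by
  rw [partialDeriv_eq_fderiv (contDiff_const.mul hf), partialDeriv_eq_fderiv hf]
  funext x
  simp [fderiv_const_mul (hf.differentiable (by simp) x)]

/-- Each differentiation of a reflected function costs a factor `-1`; in `mixedPartial_mollify` this
sign cancels the one in the definition of weak derivative. -/
lemma mixedPartial_comp_const_sub (hf : ContDiff ℝ ∞ f) (S : Finset (Fin n))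
    (x : EuclideanSpace ℝ (Fin n)) :
    mixedPartial S (fun y => f (x - y)) = fun y => (-1) ^ S.card * mixedPartial S f (x - y) := by
  induction S using Finset.induction_on with
  | empty => simp
  | insert i S hi ih =>
    have hS := contDiff_mixedPartial hf S
    have hS' : ContDiff ℝ ∞ fun y => mixedPartial S f (x - y) :=
      hS.comp (contDiff_const.sub contDiff_id)
    have hx : ContDiff ℝ ∞ fun y => f (x - y) := hf.comp (contDiff_const.sub contDiff_id)
    rw [mixedPartial_insert hx hi, ih,
      partialDeriv_const_smul _ hS', mixedPartial_insert hf hi, partialDeriv_eq_fderiv hS',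
      partialDeriv_eq_fderiv hS, Finset.card_insert_of_notMem hi]
    funext y
    have hd : HasFDerivAt (fun y => mixedPartial S f (x - y)) _ y :=
      ((hS.differentiable (by simp) (x - y)).hasFDerivAt).comp y ((hasFDerivAt_id y).const_sub x)
    beta_reduce
    rw [hd.fderiv]
    simp [pow_succ]

end Calculus

/-! ### Weak mixed derivatives and their composition -/

section WeakDerivative

variable {n : ℕ} {S R : Finset (Fin n)} {u g h : EuclideanSpace ℝ (Fin n) → ℝ}

lemma HasWeakMixedDeriv.ae_eq (hg : HasWeakMixedDeriv S u g) (hh : HasWeakMixedDeriv S u h) :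
    g =ᵐ[volume] h := by
  refine ae_eq_of_integral_contDiff_smul_eq hg.2.1 hh.2.1 fun φ hφ hc => ?_
  have h1 := (hg.2.2 φ hφ hc).symm.trans (hh.2.2 φ hφ hc)
  have h2 : (-1 : ℝ) ^ S.card ≠ 0 := pow_ne_zero _ (by norm_num)
  simpa [mul_comm] using mul_left_cancel₀ h2 h1

lemma HasWeakMixedDeriv.weakDeriv (hg : HasWeakMixedDeriv S u g) :
    HasWeakMixedDeriv S u (weakDeriv S u) := by
  have : ∃ g, HasWeakMixedDeriv S u g := ⟨g, hg⟩
  rw [_root_.weakDeriv, dif_pos this]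
  exact this.choose_spec

lemma HasWeakMixedDeriv.weakDeriv_ae_eq (hg : HasWeakMixedDeriv S u g) :
    _root_.weakDeriv S u =ᵐ[volume] g :=
  hg.weakDeriv.ae_eq hg

lemma hasWeakMixedDeriv_empty (hu : LocallyIntegrable u) : HasWeakMixedDeriv ∅ u u :=
  ⟨hu, hu, fun φ _ _ => by simp⟩

/-- Test the derivative `g` of `u` against `mixedPartial R φ`, itself an admissible test function;
the signs multiply because `R` and `S` are disjoint. -/
lemma HasWeakMixedDeriv.of_union (hSR : Disjoint R S) (hg : HasWeakMixedDeriv S u g)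
    (hh : HasWeakMixedDeriv (R ∪ S) u h) : HasWeakMixedDeriv R g h := by
  refine ⟨hg.2.1, hh.2.1, fun φ hφ hc => ?_⟩
  have h1 := hg.2.2 _ (contDiff_mixedPartial hφ R) (hasCompactSupport_mixedPartial hφ hc R)
  rw [mixedPartial_mixedPartial hφ hSR.symm, Finset.union_comm, hh.2.2 φ hφ hc,
    Finset.card_union_of_disjoint hSR, pow_add, mul_comm ((-1 : ℝ) ^ R.card), mul_assoc] at h1
  exact (mul_left_cancel₀ (pow_ne_zero _ (by norm_num)) h1).symm

/-- `g` has all weak derivatives in the variables outside `S`, and they are in `L_p`. -/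
def HasTransversalDerivs {n : ℕ} (p : ℝ≥0∞) (S : Finset (Fin n))
    (g : EuclideanSpace ℝ (Fin n) → ℝ) : Prop :=
  ∀ R : Finset (Fin n), Disjoint R S →
    HasWeakMixedDeriv R g (weakDeriv R g) ∧ MemLp (weakDeriv R g) p

variable {p : ℝ≥0∞}

lemma MemSobolevS.hasWeakMixedDeriv (hp : 1 ≤ p) (hu : MemSobolevS p u) (S : Finset (Fin n)) :
    HasWeakMixedDeriv S u (weakDeriv S u) ∧ MemLp (weakDeriv S u) p := by
  have key : ∃ g, HasWeakMixedDeriv S u g ∧ MemLp g p := by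
    rcases S.eq_empty_or_nonempty with rfl | hS
    · exact ⟨u, hasWeakMixedDeriv_empty (hu.1.locallyIntegrable hp), hu.1⟩
    · exact hu.2 S hS
  obtain ⟨g, hg, hgp⟩ := key
  exact ⟨hg.weakDeriv, (memLp_congr_ae hg.weakDeriv_ae_eq).2 hgp⟩

lemma MemSobolevS.weakDeriv_empty_ae_eq (hp : 1 ≤ p) (hu : MemSobolevS p u) :
    weakDeriv ∅ u =ᵐ[volume] u :=
  (hasWeakMixedDeriv_empty (hu.1.locallyIntegrable hp)).weakDeriv_ae_eq

lemma MemSobolevS.weakDeriv_weakDeriv_ae_eq (hp : 1 ≤ p) (hu : MemSobolevS p u)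
    (hSR : Disjoint R S) : weakDeriv R (weakDeriv S u) =ᵐ[volume] weakDeriv (R ∪ S) u :=
  ((hu.hasWeakMixedDeriv hp S).1.of_union hSR (hu.hasWeakMixedDeriv hp (R ∪ S)).1).weakDeriv_ae_eq

/-- Differentiating in variables outside `S` again yields mixed derivatives of `u` in distinct
variables. This is why the derivatives of `u` have traces. -/
lemma MemSobolevS.hasTransversalDerivs (hp : 1 ≤ p) (hu : MemSobolevS p u) (S : Finset (Fin n)) :
    HasTransversalDerivs p S (weakDeriv S u) := fun R hR =>
  ⟨((hu.hasWeakMixedDeriv hp S).1.of_union hR (hu.hasWeakMixedDeriv hp (R ∪ S)).1).weakDeriv,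
    (memLp_congr_ae (hu.weakDeriv_weakDeriv_ae_eq hp hR)).2 (hu.hasWeakMixedDeriv hp (R ∪ S)).2⟩

end WeakDerivative

/-! ### Mollification: derivatives, norm bounds and convergence -/

section Mollification

open ContinuousLinearMap (lsmul)
open scoped Convolution

variable {n : ℕ}

/-- Convolution with a normalized bump function. -/
noncomputable def mollify {n : ℕ} (φ : ContDiffBump (0 : EuclideanSpace ℝ (Fin n)))
    (g : EuclideanSpace ℝ (Fin n) → ℝ) : EuclideanSpace ℝ (Fin n) → ℝ :=
  φ.normed volume ⋆[lsmul ℝ ℝ, volume] g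

variable {g h ρ u : EuclideanSpace ℝ (Fin n) → ℝ} {φ : ContDiffBump (0 : EuclideanSpace ℝ (Fin n))}
  {S : Finset (Fin n)}

lemma mollify_apply (x : EuclideanSpace ℝ (Fin n)) :
    mollify φ g x = ∫ t, φ.normed volume t * g (x - t) := rfl

lemma contDiff_mollify (hg : LocallyIntegrable g) : ContDiff ℝ ∞ (mollify φ g) :=
  φ.hasCompactSupport_normed.contDiff_convolution_left _ φ.contDiff_normed hg

lemma mollify_sub (hg : LocallyIntegrable g) (hh : LocallyIntegrable h) :
    mollify φ (g - h) = mollify φ g - mollify φ h := by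
  have hex : ∀ {g : EuclideanSpace ℝ (Fin n) → ℝ}, LocallyIntegrable g → ∀ x,
      Integrable fun t => φ.normed volume t * g (x - t) := fun hg x =>
    φ.hasCompactSupport_normed.convolutionExists_left (lsmul ℝ ℝ) φ.continuous_normed hg x
  funext x
  simp only [mollify_apply, Pi.sub_apply, mul_sub]
  exact integral_sub (hex hg x) (hex hh x)

lemma partialDeriv_convolution (hρ : ContDiff ℝ ∞ ρ) (hc : HasCompactSupport ρ)
    (hu : LocallyIntegrable u) (i : Fin n) :
    partialDeriv i (ρ ⋆[lsmul ℝ ℝ, volume] u) = partialDeriv i ρ ⋆[lsmul ℝ ℝ, volume] u := by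
  have hs : ContDiff ℝ ∞ (ρ ⋆[lsmul ℝ ℝ, volume] u) := hc.contDiff_convolution_left _ hρ hu
  rw [partialDeriv_eq_fderiv hs]
  funext x
  rw [(hc.hasFDerivAt_convolution_left (lsmul ℝ ℝ) (hρ.of_le (by simp)) hu x).fderiv]
  have hex := (hc.fderiv ℝ).convolutionExists_left
    ((lsmul ℝ ℝ).precompL (EuclideanSpace ℝ (Fin n)))
    (hρ.continuous_fderiv (by simp)) hu x
  rw [convolution_def, ContinuousLinearMap.integral_apply hex, convolution_def,
    partialDeriv_eq_fderiv hρ]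
  rfl

lemma mixedPartial_convolution (hρ : ContDiff ℝ ∞ ρ) (hc : HasCompactSupport ρ)
    (hu : LocallyIntegrable u) (S : Finset (Fin n)) :
    mixedPartial S (ρ ⋆[lsmul ℝ ℝ, volume] u) = mixedPartial S ρ ⋆[lsmul ℝ ℝ, volume] u := by
  have hs : ContDiff ℝ ∞ (ρ ⋆[lsmul ℝ ℝ, volume] u) := hc.contDiff_convolution_left _ hρ hu
  induction S using Finset.induction_on with
  | empty => simp
  | insert i S hi ih =>
    rw [mixedPartial_insert hs hi, ih, partialDeriv_convolution (contDiff_mixedPartial hρ S)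
      (hasCompactSupport_mixedPartial hρ hc S) hu, mixedPartial_insert hρ hi]

/-- Put the derivatives on the kernel, then use `y ↦ ρ (x - y)` as test function in the definition
of the weak derivative. -/
lemma mixedPartial_mollify (h : HasWeakMixedDeriv S u g) :
    mixedPartial S (mollify φ u) = mollify φ g := by
  have hρ : ContDiff ℝ ∞ (φ.normed volume) := φ.contDiff_normed
  have hc : HasCompactSupport (φ.normed volume) := φ.hasCompactSupport_normed
  rw [mollify, mixedPartial_convolution hρ hc h.1]
  funext x
  have hx : ContDiff ℝ ∞ fun y => φ.normed volume (x - y) :=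
    hρ.comp (contDiff_const.sub contDiff_id)
  have hcx : HasCompactSupport fun y => φ.normed volume (x - y) :=
    hc.comp_homeomorph (Homeomorph.subLeft x)
  have h1 := h.2.2 _ hx hcx
  rw [mixedPartial_comp_const_sub hρ] at h1
  simp only [mul_left_comm _ ((-1 : ℝ) ^ S.card), integral_const_mul] at h1
  have h2 := mul_left_cancel₀ (pow_ne_zero _ (by norm_num)) h1
  rw [mollify, convolution_lsmul_swap, convolution_lsmul_swap]
  simpa [mul_comm] using h2

lemma lintegral_enorm_normed : ∫⁻ t, ‖φ.normed volume t‖ₑ = 1 := by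
  have h1 : ∀ t, ‖φ.normed volume t‖ₑ = ENNReal.ofReal (φ.normed volume t) := fun t =>
    Real.enorm_of_nonneg (φ.nonneg_normed t)
  simp_rw [h1]
  rw [← ofReal_integral_eq_lintegral_ofReal φ.integrable_normed
    (Eventually.of_forall φ.nonneg_normed), φ.integral_normed, ENNReal.ofReal_one]

lemma enorm_mollify_le (x : EuclideanSpace ℝ (Fin n)) :
    ‖mollify φ g x‖ₑ ≤ ∫⁻ t, ‖φ.normed volume t‖ₑ * ‖g (x - t)‖ₑ := by
  rw [mollify_apply]
  exact (enorm_integral_le_lintegral_enorm _).trans_eq (by simp [enorm_mul])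

lemma enorm_mollify_le_eLpNorm_top (x : EuclideanSpace ℝ (Fin n)) :
    ‖mollify φ g x‖ₑ ≤ eLpNorm g ⊤ volume := by
  refine (enorm_mollify_le x).trans ?_
  have hb : ∀ᵐ t, ‖g (x - t)‖ₑ ≤ eLpNorm g ⊤ volume :=
    (quasiMeasurePreserving_sub_left_of_right_invariant volume x).ae (ae_le_eLpNormEssSup)
  calc _ ≤ ∫⁻ t, ‖φ.normed volume t‖ₑ * eLpNorm g ⊤ volume := by
        refine lintegral_mono_ae ?_
        filter_upwards [hb] with t ht
        gcongr
    _ = eLpNorm g ⊤ volume := by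
        rw [lintegral_mul_const _ φ.continuous_normed.enorm.measurable, lintegral_enorm_normed,
          one_mul]

/-- Jensen's inequality for the probability measure whose density is the bump function. -/
lemma enorm_mollify_rpow_le {q : ℝ} (hq : 1 ≤ q) (hg : AEStronglyMeasurable g)
    (x : EuclideanSpace ℝ (Fin n)) :
    ‖mollify φ g x‖ₑ ^ q ≤ ∫⁻ t, ‖φ.normed volume t‖ₑ * ‖g (x - t)‖ₑ ^ q := by
  have hmeas : Measurable fun t => ‖φ.normed volume t‖ₑ :=
    φ.continuous_normed.enorm.measurable
  set ν : Measure (EuclideanSpace ℝ (Fin n)) :=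
    volume.withDensity fun t => ‖φ.normed volume t‖ₑ with hν
  have : IsProbabilityMeasure ν := ⟨by
    rw [hν, withDensity_apply _ MeasurableSet.univ, Measure.restrict_univ, lintegral_enorm_normed]⟩
  have hgx : AEStronglyMeasurable (fun t => g (x - t)) volume :=
    hg.comp_quasiMeasurePreserving (quasiMeasurePreserving_sub_left_of_right_invariant volume x)
  have hgν : AEStronglyMeasurable (fun t => g (x - t)) ν :=
    hgx.mono_ac (withDensity_absolutelyContinuous _ _)
  have hw : ∀ r : ℝ, ∫⁻ t, ‖φ.normed volume t‖ₑ * ‖g (x - t)‖ₑ ^ r =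
      ∫⁻ t, ‖g (x - t)‖ₑ ^ r ∂ν := fun r => by
    rw [hν, lintegral_withDensity_eq_lintegral_mul₀ hmeas.aemeasurable (hgx.enorm.pow_const r)]
    rfl
  have hj := eLpNorm'_le_eLpNorm'_of_exponent_le one_pos hq ν hgν
  simp only [eLpNorm'] at hj
  have h1 := hw 1
  simp only [ENNReal.rpow_one, one_div, inv_one] at h1 hj
  calc ‖mollify φ g x‖ₑ ^ q ≤ (∫⁻ t, ‖g (x - t)‖ₑ ∂ν) ^ q := by
        gcongr
        exact (enorm_mollify_le x).trans_eq h1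
    _ ≤ ((∫⁻ t, ‖g (x - t)‖ₑ ^ q ∂ν) ^ q⁻¹) ^ q := by gcongr
    _ = _ := by rw [← ENNReal.rpow_mul, inv_mul_cancel₀ (by positivity), ENNReal.rpow_one, hw]

/-- Integrate the pointwise Jensen bound, exchange the integrals and use translation invariance. -/
lemma eLpNorm_mollify_le {q : ℝ≥0∞} (hq : 1 ≤ q) (hq' : q ≠ ⊤) (hg : AEStronglyMeasurable g) :
    eLpNorm (mollify φ g) q volume ≤ eLpNorm g q volume := by
  have hq0 : q ≠ 0 := (zero_lt_one.trans_le hq).ne'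
  have hq1 : 1 ≤ q.toReal := by
    rw [← ENNReal.toReal_one]; exact ENNReal.toReal_mono hq' hq
  rw [eLpNorm_eq_lintegral_rpow_enorm_toReal hq0 hq', eLpNorm_eq_lintegral_rpow_enorm_toReal hq0 hq']
  gcongr ?_ ^ _
  have hmeas : Measurable fun t => ‖φ.normed volume t‖ₑ :=
    φ.continuous_normed.enorm.measurable
  calc ∫⁻ x, ‖mollify φ g x‖ₑ ^ q.toReal
      ≤ ∫⁻ x, ∫⁻ t, ‖φ.normed volume t‖ₑ * ‖g (x - t)‖ₑ ^ q.toReal :=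
        lintegral_mono fun x => enorm_mollify_rpow_le hq1 hg x
    _ = ∫⁻ t, ∫⁻ x, ‖φ.normed volume t‖ₑ * ‖g (x - t)‖ₑ ^ q.toReal := by
        refine lintegral_lintegral_swap ?_
        refine AEMeasurable.mul (hmeas.comp measurable_snd).aemeasurable ?_
        exact (hg.comp_quasiMeasurePreserving
          (quasiMeasurePreserving_sub_of_right_invariant volume volume)).enorm.pow_const _
    _ = ∫⁻ t, ‖φ.normed volume t‖ₑ * ∫⁻ x, ‖g x‖ₑ ^ q.toReal := by
        refine lintegral_congr fun t => ?_
        rw [lintegral_const_mul' _ _ (by simp),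
          lintegral_sub_right_eq_self (fun x => ‖g x‖ₑ ^ q.toReal)]
    _ = ∫⁻ x, ‖g x‖ₑ ^ q.toReal := by
        rw [lintegral_mul_const _ hmeas, lintegral_enorm_normed, one_mul]

variable {ψ : ℕ → ContDiffBump (0 : EuclideanSpace ℝ (Fin n))}

/-- A continuous function of compact support is uniformly continuous, so the convergence is uniform;
a finite measure turns this into convergence in every `L_q`. -/
lemma tendsto_eLpNorm_mollify_sub_of_continuous (hψ : Tendsto (fun m => (ψ m).rOut) atTop (𝓝 0))
    (hc : Continuous g) (hs : HasCompactSupport g) (q : ℝ≥0∞)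
    (μ : Measure (EuclideanSpace ℝ (Fin n))) [IsFiniteMeasure μ] :
    Tendsto (fun m => eLpNorm (mollify (ψ m) g - g) q μ) atTop (𝓝 0) := by
  have hK : μ Set.univ ^ q.toReal⁻¹ ≠ ⊤ := by finiteness
  refine ENNReal.tendsto_nhds_zero.2 fun ε hε => ?_
  obtain ⟨δ, hδ, hδε⟩ : ∃ δ : ℝ≥0, 0 < δ ∧ μ Set.univ ^ q.toReal⁻¹ * δ ≤ ε := by
    have h0 : Tendsto (fun δ : ℝ≥0 => μ Set.univ ^ q.toReal⁻¹ * δ) (𝓝 0) (𝓝 0) := by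
      simpa using ENNReal.Tendsto.const_mul (a := μ Set.univ ^ q.toReal⁻¹)
        (ENNReal.tendsto_coe.2 (tendsto_id (x := 𝓝 (0 : ℝ≥0)))) (Or.inr hK)
    have := ENNReal.tendsto_nhds_zero.1 h0 ε hε
    obtain ⟨δ, h1, h2⟩ := ((this.filter_mono nhdsWithin_le_nhds).and
      (self_mem_nhdsWithin : Set.Ioi (0 : ℝ≥0) ∈ 𝓝[>] 0)).exists
    exact ⟨δ, h2, h1⟩
  obtain ⟨r, hr, hr'⟩ := Metric.uniformContinuous_iff.1 (hc.uniformContinuous_of_tendsto_cocompact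
    (hs.is_zero_at_infty)) δ (by exact_mod_cast hδ)
  filter_upwards [(tendsto_order.1 hψ).2 r hr] with m hm
  have hb : ∀ᵐ x ∂μ, ‖(mollify (ψ m) g - g) x‖ ≤ δ := Eventually.of_forall fun x => by
    rw [Pi.sub_apply, ← dist_eq_norm]
    exact (ψ m).dist_normed_convolution_le hc.aestronglyMeasurable fun y hy =>
      (hr' ((Metric.mem_ball.1 hy).trans hm)).le
  refine (eLpNorm_le_of_ae_bound hb).trans ?_
  simpa using hδε

/-- Approximate `g` by a compactly supported continuous function; the error is not increased by
mollification. -/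
lemma tendsto_eLpNorm_mollify_sub {q : ℝ≥0∞} (hq : 1 ≤ q) (hq' : q ≠ ⊤)
    (hψ : Tendsto (fun m => (ψ m).rOut) atTop (𝓝 0)) (hg : MemLp g q)
    {s : Set (EuclideanSpace ℝ (Fin n))} (hs : volume s ≠ ⊤) :
    Tendsto (fun m => eLpNorm (mollify (ψ m) g - g) q (volume.restrict s)) atTop (𝓝 0) := by
  have : IsFiniteMeasure (volume.restrict s) := isFiniteMeasure_restrict.2 hs
  refine ENNReal.tendsto_nhds_zero.2 fun ε hε => ?_
  have hε3 : ε / 3 ≠ 0 := by simpa using hε.ne'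
  obtain ⟨h, hhs, hgh, hhc, hhq⟩ := hg.exists_hasCompactSupport_eLpNorm_sub_le hq' hε3
  have hgl := hg.locallyIntegrable hq
  have hhl : LocallyIntegrable h := hhc.locallyIntegrable
  filter_upwards [ENNReal.tendsto_nhds_zero.1
    (tendsto_eLpNorm_mollify_sub_of_continuous hψ hhc hhs q (volume.restrict s)) (ε / 3)
    (pos_iff_ne_zero.2 hε3)] with m hm
  have hM : ∀ {g : EuclideanSpace ℝ (Fin n) → ℝ}, LocallyIntegrable g →
      Continuous (mollify (ψ m) g) := fun hg => (contDiff_mollify hg).continuous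
  have hsplit : mollify (ψ m) g - g = mollify (ψ m) (g - h) + (mollify (ψ m) h - h) - (g - h) := by
    rw [mollify_sub hgl hhl]; abel
  have m1 : AEStronglyMeasurable (mollify (ψ m) (g - h)) (volume.restrict s) :=
    (hM (hgl.sub hhl)).aestronglyMeasurable
  have m2 : AEStronglyMeasurable (mollify (ψ m) h - h) (volume.restrict s) :=
    ((hM hhl).sub hhc).aestronglyMeasurable
  have m3 : AEStronglyMeasurable (g - h) volume := (hg.sub hhq).1
  rw [hsplit]
  calc _ ≤ eLpNorm (mollify (ψ m) (g - h)) q (volume.restrict s) +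
          eLpNorm (mollify (ψ m) h - h) q (volume.restrict s) +
          eLpNorm (g - h) q (volume.restrict s) :=
        (eLpNorm_sub_le (m1.add m2) m3.restrict hq).trans (by gcongr; exact eLpNorm_add_le m1 m2 hq)
    _ ≤ ε / 3 + ε / 3 + ε / 3 := by
        gcongr
        · exact (eLpNorm_mono_measure _ Measure.restrict_le_self).trans
            ((eLpNorm_mollify_le hq hq' m3).trans hgh)
        · exact (eLpNorm_mono_measure _ Measure.restrict_le_self).trans hgh
    _ = ε := ENNReal.add_thirds ε

lemma mollify_indicator_thickening {s : Set (EuclideanSpace ℝ (Fin n))} (hφ : φ.rOut ≤ 1)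
    {x : EuclideanSpace ℝ (Fin n)} (hx : x ∈ s) :
    mollify φ ((Metric.thickening 1 s).indicator g) x = mollify φ g x := by
  rw [mollify_apply, mollify_apply]
  refine integral_congr_ae (Eventually.of_forall fun t => ?_)
  by_cases ht : φ.normed volume t = 0
  · simp [ht]
  have ht' : t ∈ Metric.ball (0 : EuclideanSpace ℝ (Fin n)) φ.rOut := by
    rw [← φ.support_normed_eq (μ := volume)]
    exact ht
  have : x - t ∈ Metric.thickening 1 s :=
    Metric.mem_thickening_iff.2 ⟨x, hx, by simpa using (mem_ball_zero_iff.1 ht').trans_le hφ⟩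
  simp [this]

/-- A function in `L_p` need not be globally in `L_q` for `q < p`. On `s`, mollification at scale at
most `1` only sees the 1-neighbourhood of `s`, so `g` may be cut off outside it. -/
lemma tendsto_eLpNorm_mollify_sub_of_isBounded {p q : ℝ≥0∞} (hq : 1 ≤ q) (hqp : q ≤ p)
    (hq' : q ≠ ⊤) (hψ : Tendsto (fun m => (ψ m).rOut) atTop (𝓝 0)) (hg : MemLp g p)
    {s : Set (EuclideanSpace ℝ (Fin n))} (hs : Bornology.IsBounded s) (hsm : MeasurableSet s) :
    Tendsto (fun m => eLpNorm (mollify (ψ m) g - g) q (volume.restrict s)) atTop (𝓝 0) := by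
  have htf : volume (Metric.thickening 1 s) < ⊤ := (hs.thickening (δ := 1)).measure_lt_top
  have : IsFiniteMeasure (volume.restrict (Metric.thickening 1 s)) :=
    isFiniteMeasure_restrict.2 htf.ne
  have hg' : MemLp ((Metric.thickening 1 s).indicator g) q :=
    (memLp_indicator_iff_restrict Metric.isOpen_thickening.measurableSet).2
      (hg.restrict _ |>.mono_exponent hqp)
  refine (tendsto_eLpNorm_mollify_sub hq hq' hψ hg' hs.measure_lt_top.ne).congr' ?_
  filter_upwards [(tendsto_order.1 hψ).2 1 one_pos] with m hm
  refine eLpNorm_congr_ae ?_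
  filter_upwards [ae_restrict_mem hsm] with x hx
  rw [Pi.sub_apply, Pi.sub_apply, mollify_indicator_thickening hm.le hx,
    Set.indicator_of_mem (Metric.self_subset_thickening one_pos s hx)]

/-- A sequence of bump functions shrinking to the origin. -/
noncomputable def shrinkingBump (n m : ℕ) : ContDiffBump (0 : EuclideanSpace ℝ (Fin n)) where
  rIn := 1 / (m + 1)
  rOut := 2 * (1 / (m + 1))
  rIn_pos := by positivity
  rIn_lt_rOut := by
    have : (0 : ℝ) < 1 / (m + 1) := by positivity
    linarith

lemma tendsto_rOut_shrinkingBump (n : ℕ) :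
    Tendsto (fun m => (shrinkingBump n m).rOut) atTop (𝓝 0) := by
  simpa [shrinkingBump] using (tendsto_one_div_add_atTop_nhds_zero_nat (𝕜 := ℝ)).const_mul 2

/-- Lebesgue differentiation; it needs the ratio of outer to inner radius to stay bounded, here by
`2`. -/
lemma ae_tendsto_mollify_shrinkingBump (hg : LocallyIntegrable g) :
    ∀ᵐ x, Tendsto (fun m => mollify (shrinkingBump n m) g x) atTop (𝓝 (g x)) :=
  ContDiffBump.ae_convolution_tendsto_right_of_locallyIntegrable (K := 2)
    (tendsto_rOut_shrinkingBump n) (Eventually.of_forall fun _ => le_rfl) hg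

end Mollification

/-! ### Estimates and the Newton-Leibniz formula on boxes, for smooth functions -/

section Boxes

open Set (Icc)

/-- `c` is admissible in the bound of the `q`-th power of `φ` at the left endpoint of `[a, b]`
by the integrals of the `q`-th powers of `φ` and `φ'`. -/
def EndpointBound (q : ℝ) (c : ℝ≥0∞) (a b : ℝ) : Prop :=
  ∀ φ φ' : ℝ → ℝ, Continuous φ' → (∀ t, HasDerivAt φ (φ' t) t) →
    ‖φ a‖ₑ ^ q ≤ c * ((∫⁻ t in Icc a b, ‖φ t‖ₑ ^ q) + ∫⁻ t in Icc a b, ‖φ' t‖ₑ ^ q)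

lemma enorm_sub_le_lintegral_enorm_deriv {φ φ' : ℝ → ℝ} (hc : Continuous φ')
    (hd : ∀ t, HasDerivAt φ (φ' t) t) {a b t : ℝ} (ht : t ∈ Icc a b) :
    ‖φ t - φ a‖ₑ ≤ ∫⁻ s in Icc a b, ‖φ' s‖ₑ := by
  rw [← intervalIntegral.integral_eq_sub_of_hasDerivAt (fun s _ => hd s)
    (hc.intervalIntegrable a t), intervalIntegral.integral_of_le ht.1]
  refine (enorm_integral_le_lintegral_enorm _).trans (lintegral_mono_set ?_)
  exact fun s hs => ⟨hs.1.le, hs.2.trans ht.2⟩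

/-- Average the bound `|φ a| ≤ |φ t| + ∫ |φ'|` over `t ∈ [a, b]`. -/
lemma enorm_left_le {φ φ' : ℝ → ℝ} (hc : Continuous φ')
    (hd : ∀ t, HasDerivAt φ (φ' t) t) {a b : ℝ} (hab : a < b) :
    ‖φ a‖ₑ ≤ (ENNReal.ofReal (b - a))⁻¹ * (∫⁻ t in Icc a b, ‖φ t‖ₑ) +
      ∫⁻ t in Icc a b, ‖φ' t‖ₑ := by
  set D := ∫⁻ t in Icc a b, ‖φ' t‖ₑ
  set l := ENNReal.ofReal (b - a) with hl
  have hl0 : l ≠ 0 := by simpa [hl] using hab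
  have hlt : l ≠ ⊤ := ENNReal.ofReal_ne_top
  have hv : volume (Icc a b) = l := Real.volume_Icc
  have hpt : ∀ t ∈ Icc a b, ‖φ a‖ₑ ≤ ‖φ t‖ₑ + D := fun t ht => by
    calc ‖φ a‖ₑ = ‖φ t - (φ t - φ a)‖ₑ := by rw [sub_sub_cancel]
      _ ≤ ‖φ t‖ₑ + ‖φ t - φ a‖ₑ := enorm_sub_le
      _ ≤ _ := by gcongr; exact enorm_sub_le_lintegral_enorm_deriv hc hd ht
  have h1 : ‖φ a‖ₑ * l ≤ (∫⁻ t in Icc a b, ‖φ t‖ₑ) + D * l := by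
    calc ‖φ a‖ₑ * l = ∫⁻ t in Icc a b, ‖φ a‖ₑ := by rw [setLIntegral_const, hv]
      _ ≤ ∫⁻ t in Icc a b, (‖φ t‖ₑ + D) := setLIntegral_mono' measurableSet_Icc hpt
      _ = _ := by rw [lintegral_add_right _ measurable_const, setLIntegral_const, hv]
  calc ‖φ a‖ₑ = l⁻¹ * (‖φ a‖ₑ * l) := by
        rw [mul_comm ‖φ a‖ₑ, ← mul_assoc, ENNReal.inv_mul_cancel hl0 hlt, one_mul]
    _ ≤ l⁻¹ * ((∫⁻ t in Icc a b, ‖φ t‖ₑ) + D * l) := by gcongr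
    _ = _ := by
        rw [mul_add, mul_comm D, ← mul_assoc l⁻¹, ENNReal.inv_mul_cancel hl0 hlt, one_mul]

/-- On unit intervals with `q = 1` the constant is `1`, which keeps the embedding constant explicit.
-/
lemma endpointBound_one {a b : ℝ} (hab : b = a + 1) : EndpointBound 1 1 a b := by
  intro φ φ' hc hd
  subst hab
  have h := enorm_left_le hc hd (lt_add_one a)
  rw [add_sub_cancel_left] at h
  simpa using h

lemma lintegral_enorm_rpow_le {α : Type*} [MeasurableSpace α] (μ : Measure α) {f : α → ℝ}
    (hf : AEStronglyMeasurable f μ) {q : ℝ} (hq : 1 ≤ q) :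
    (∫⁻ t, ‖f t‖ₑ ∂μ) ^ q ≤ μ Set.univ ^ (q - 1) * ∫⁻ t, ‖f t‖ₑ ^ q ∂μ := by
  have h := eLpNorm'_le_eLpNorm'_mul_rpow_measure_univ one_pos hq hf
  simp only [eLpNorm', ENNReal.rpow_one, one_div, inv_one] at h
  have hq0 : q ≠ 0 := by positivity
  calc _ ≤ ((∫⁻ t, ‖f t‖ₑ ^ q ∂μ) ^ q⁻¹ * μ Set.univ ^ (1 - q⁻¹)) ^ q := by gcongr
    _ = _ := by
      rw [ENNReal.mul_rpow_of_nonneg _ _ (by positivity), ← ENNReal.rpow_mul, ← ENNReal.rpow_mul,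
        inv_mul_cancel₀ hq0, ENNReal.rpow_one, sub_mul, inv_mul_cancel₀ hq0, one_mul, mul_comm]

lemma exists_endpointBound {a b q : ℝ} (hab : a < b) (hq : 1 ≤ q) :
    ∃ c : ℝ≥0∞, c ≠ ⊤ ∧ EndpointBound q c a b := by
  set l := ENNReal.ofReal (b - a) with hl
  have hl0 : l ≠ 0 := by simpa [hl] using hab
  have hlt : l ≠ ⊤ := ENNReal.ofReal_ne_top
  have hq0 : 0 ≤ q := by linarith
  set M := volume.restrict (Icc a b) Set.univ ^ (q - 1) with hM
  have hMt : M ≠ ⊤ := ENNReal.rpow_ne_top_of_nonneg (by linarith) (by simp)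
  have hli : (l⁻¹) ^ q ≠ ⊤ := ENNReal.rpow_ne_top_of_nonneg hq0 (ENNReal.inv_ne_top.2 hl0)
  -- `2 ^ (q - 1)` comes from convexity of the power, `l⁻¹ ^ q` from the averaging, and `M = (b - a)
  -- ^ (q - 1)` from Hölder's inequality on `[a, b]`.
  refine ⟨2 ^ (q - 1) * ((l⁻¹) ^ q * M + M), ENNReal.mul_ne_top
    (ENNReal.rpow_ne_top_of_nonneg (by linarith) (by simp))
    (ENNReal.add_ne_top.2 ⟨ENNReal.mul_ne_top hli hMt, hMt⟩), fun φ φ' hc hd => ?_⟩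
  have hφ : Continuous φ := continuous_iff_continuousAt.2 fun t => (hd t).continuousAt
  calc ‖φ a‖ₑ ^ q ≤ (l⁻¹ * (∫⁻ t in Icc a b, ‖φ t‖ₑ) + ∫⁻ t in Icc a b, ‖φ' t‖ₑ) ^ q := by
        gcongr; exact enorm_left_le hc hd hab
    _ ≤ 2 ^ (q - 1) * ((l⁻¹ * (∫⁻ t in Icc a b, ‖φ t‖ₑ)) ^ q + (∫⁻ t in Icc a b, ‖φ' t‖ₑ) ^ q) :=
        ENNReal.rpow_add_le_mul_rpow_add_rpow _ _ hq
    _ ≤ 2 ^ (q - 1) * ((l⁻¹) ^ q * (M * ∫⁻ t in Icc a b, ‖φ t‖ₑ ^ q) +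
          M * ∫⁻ t in Icc a b, ‖φ' t‖ₑ ^ q) := by
        rw [ENNReal.mul_rpow_of_nonneg _ _ hq0]
        gcongr
        · exact lintegral_enorm_rpow_le _ hφ.aestronglyMeasurable hq
        · exact lintegral_enorm_rpow_le _ hc.aestronglyMeasurable hq
    _ ≤ _ := by
        rw [mul_assoc, add_mul, ← mul_assoc ((l⁻¹) ^ q)]
        gcongr
        · exact le_self_add
        · exact le_add_self

variable {n : ℕ} {x x' : EuclideanSpace ℝ (Fin n)} {S T : Finset (Fin n)} {i : Fin n}
  {f : EuclideanSpace ℝ (Fin n) → ℝ}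

/-- Lebesgue measure on the `i`-th side of the rectangle with corners `x` and `x'`. -/
noncomputable def sideMeasure {n : ℕ} (x x' : EuclideanSpace ℝ (Fin n)) (i : Fin n) : Measure ℝ :=
  volume.restrict (Icc (x i) (x' i))

instance : IsFiniteMeasure (sideMeasure x x' i) := by
  unfold sideMeasure; infer_instance

lemma subRect_eq_pi : subRect x x' S = Set.pi Set.univ fun i : S => Icc (x i) (x' i) := by
  ext; simp [subRect, -Set.pi_univ_Icc]

lemma rect_eq_preimage :
    rect x x' = WithLp.ofLp ⁻¹' Set.pi Set.univ fun i => Icc (x i) (x' i) := by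
  ext; simp [rect, -Set.pi_univ_Icc]

lemma volume_restrict_subRect :
    volume.restrict (subRect x x' S) = Measure.pi fun i : S => sideMeasure x x' i := by
  rw [subRect_eq_pi, volume_pi, Measure.restrict_pi_pi]
  rfl

lemma isCompact_subRect : IsCompact (subRect x x' S) := by
  rw [subRect_eq_pi]
  exact isCompact_univ_pi fun _ => isCompact_Icc

lemma isCompact_rect : IsCompact (rect x x') := by
  rw [rect_eq_preimage]
  exact (PiLp.homeomorph 2 fun _ : Fin n => ℝ).isCompact_preimage.2
    (isCompact_univ_pi fun _ => isCompact_Icc)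

lemma continuous_extendBy : Continuous (extendBy x S) := by
  refine (PiLp.continuous_toLp 2 _).comp (continuous_pi fun i => ?_)
  by_cases h : i ∈ S
  · simpa [h] using continuous_apply _
  · simpa [h] using continuous_const

lemma extendBy_eq_toLp (z : EuclideanSpace ℝ (Fin n)) (η : S → ℝ) :
    extendBy z S η = WithLp.toLp 2 (Function.updateFinset z.ofLp S η) := rfl

/-- Face integrals become marginals, which can be integrated out one coordinate at a time. -/
lemma lintegral_subRect (F : EuclideanSpace ℝ (Fin n) → ℝ≥0∞) (z : EuclideanSpace ℝ (Fin n)) :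
    ∫⁻ η in subRect x x' S, F (extendBy z S η) =
      lmarginal (sideMeasure x x') S (fun y => F (WithLp.toLp 2 y)) z.ofLp := by
  rw [volume_restrict_subRect]
  rfl

lemma lintegral_rect (F : EuclideanSpace ℝ (Fin n) → ℝ≥0∞) (z : Fin n → ℝ) :
    ∫⁻ y in rect x x', F y =
      lmarginal (sideMeasure x x') Finset.univ (fun y => F (WithLp.toLp 2 y)) z := by
  have hmp := (PiLp.volume_preserving_toLp (Fin n)).restrict_preimage_emb
    (MeasurableEquiv.toLp 2 (Fin n → ℝ)).measurableEmbedding (rect x x')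
  rw [lmarginal_univ, ← hmp.lintegral_comp_emb
    (MeasurableEquiv.toLp 2 (Fin n → ℝ)).measurableEmbedding]
  have : (WithLp.toLp 2 ⁻¹' rect x x' : Set (Fin n → ℝ)) =
      Set.pi Set.univ fun i => Icc (x i) (x' i) := by
    ext; simp [rect, -Set.pi_univ_Icc]
  rw [this, volume_pi, Measure.restrict_pi_pi]
  rfl

lemma hasDerivAt_toLp_update (hf : ContDiff ℝ ∞ f) (y : Fin n → ℝ) (i : Fin n) (t : ℝ) :
    HasDerivAt (fun t => f (WithLp.toLp 2 (Function.update y i t)))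
      (partialDeriv i f (WithLp.toLp 2 (Function.update y i t))) t := by
  have hline : ∀ t, WithLp.toLp 2 (Function.update y i t) =
      WithLp.toLp 2 y + (t - y i) • EuclideanSpace.single i (1 : ℝ) := fun t => by
    ext j
    by_cases h : j = i
    · subst h; simp
    · simp [h]
  have hd : HasDerivAt (fun t => WithLp.toLp 2 y + (t - y i) • EuclideanSpace.single i (1 : ℝ))
      (EuclideanSpace.single i (1 : ℝ)) t := by
    simpa using (((hasDerivAt_id t).sub_const (y i)).smul_const
      (EuclideanSpace.single i (1 : ℝ))).const_add (WithLp.toLp 2 y)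
  rw [partialDeriv_eq_fderiv hf]
  simp_rw [hline]
  exact (hf.differentiable (by simp) _).hasFDerivAt.comp_hasDerivAt t hd

lemma continuous_toLp_update (y : Fin n → ℝ) (i : Fin n) :
    Continuous fun t : ℝ => (WithLp.toLp 2 (Function.update y i t) : EuclideanSpace ℝ (Fin n)) :=
  (PiLp.continuous_toLp 2 _).comp (continuous_const.update i continuous_id)

lemma measurable_enorm_rpow_toLp (hf : Continuous f) (q : ℝ) :
    Measurable fun y : Fin n → ℝ => ‖f (WithLp.toLp 2 y)‖ₑ ^ q :=
  ((hf.comp (PiLp.continuous_toLp 2 _)).enorm.measurable).pow_const q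

lemma lmarginal_le_lmarginal_insert {q : ℝ} {c : ℝ≥0∞} (hf : ContDiff ℝ ∞ f)
    (hi : i ∉ S) (hc : EndpointBound q c (x i) (x' i)) :
    lmarginal (sideMeasure x x') S (fun y => ‖f (WithLp.toLp 2 y)‖ₑ ^ q) x.ofLp ≤
      c * (lmarginal (sideMeasure x x') (insert i S) (fun y => ‖f (WithLp.toLp 2 y)‖ₑ ^ q) x.ofLp +
        lmarginal (sideMeasure x x') (insert i S)
          (fun y => ‖partialDeriv i f (WithLp.toLp 2 y)‖ₑ ^ q) x.ofLp) := by
  have hf' := contDiff_partialDeriv hf i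
  have m1 := measurable_enorm_rpow_toLp hf.continuous q
  have m2 := measurable_enorm_rpow_toLp hf'.continuous q
  rw [lmarginal_insert' _ m1 hi, lmarginal_insert' _ m2 hi]
  have m3 : Measurable fun y : Fin n → ℝ =>
      ∫⁻ t, ‖f (WithLp.toLp 2 (Function.update y i t))‖ₑ ^ q ∂sideMeasure x x' i := by
    rw [← lmarginal_singleton (μ := sideMeasure x x') (fun y => ‖f (WithLp.toLp 2 y)‖ₑ ^ q) i]
    exact m1.lmarginal _
  have m4 : Measurable fun y : Fin n → ℝ =>
      ∫⁻ t, ‖partialDeriv i f (WithLp.toLp 2 (Function.update y i t))‖ₑ ^ q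
        ∂sideMeasure x x' i := by
    rw [← lmarginal_singleton (μ := sideMeasure x x')
      (fun y => ‖partialDeriv i f (WithLp.toLp 2 y)‖ₑ ^ q) i]
    exact m2.lmarginal _
  simp only [lmarginal]
  have m5 := m3.comp (measurable_updateFinset (s := S) (x := x.ofLp))
  have m6 := m4.comp (measurable_updateFinset (s := S) (x := x.ofLp))
  simp only [Function.comp_def] at m5 m6
  rw [← lintegral_add_left m5, ← lintegral_const_mul _ (m5.fun_add m6)]
  refine lintegral_mono fun η => ?_
  set y := Function.updateFinset x.ofLp S η with hy
  -- The face lies at the left end of the `i`-th side, exactly where the endpoint bound applies.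
  have hyi : y i = x i := by simp [hy, Function.updateFinset, hi]
  have := hc _ _ (hf'.continuous.comp (continuous_toLp_update y i))
    (hasDerivAt_toLp_update hf y i)
  rwa [← hyi, Function.update_eq_self, hyi] at this

/-- Thickening the face in direction `i` replaces each term by itself and its `i`-th derivative;
over all `i ∈ T` this generates every subset of `T` once. -/
lemma lmarginal_le_sum_lmarginal_union {q : ℝ} {c : ℝ≥0∞} (hf : ContDiff ℝ ∞ f)
    (hST : Disjoint T S) (hc : ∀ i ∈ T, EndpointBound q c (x i) (x' i)) :
    lmarginal (sideMeasure x x') S (fun y => ‖f (WithLp.toLp 2 y)‖ₑ ^ q) x.ofLp ≤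
      c ^ T.card * ∑ R ∈ T.powerset, lmarginal (sideMeasure x x') (T ∪ S)
        (fun y => ‖mixedPartial R f (WithLp.toLp 2 y)‖ₑ ^ q) x.ofLp := by
  induction T using Finset.induction_on with
  | empty => simp
  | insert i T hi ih =>
    rw [Finset.disjoint_insert_left] at hST
    have hiT : i ∉ T ∪ S := by simp [hi, hST.1]
    refine (ih hST.2 fun j hj => hc j (Finset.mem_insert_of_mem hj)).trans ?_
    rw [Finset.card_insert_of_notMem hi, pow_succ, mul_assoc, Finset.sum_powerset_insert hi,
      ← Finset.sum_add_distrib, Finset.insert_union]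
    gcongr
    rw [Finset.mul_sum]
    refine Finset.sum_le_sum fun R hR => ?_
    rw [mixedPartial_insert hf fun h => hi (Finset.mem_powerset.1 hR h)]
    exact lmarginal_le_lmarginal_insert (contDiff_mixedPartial hf R) hiT
      (hc i (Finset.mem_insert_self _ _))

lemma lintegral_subRect_le {q : ℝ} {c : ℝ≥0∞} (hf : ContDiff ℝ ∞ f)
    (hc : ∀ i ∉ S, EndpointBound q c (x i) (x' i)) :
    ∫⁻ η in subRect x x' S, ‖f (extendBy x S η)‖ₑ ^ q ≤
      c ^ Sᶜ.card * ∑ R ∈ Sᶜ.powerset, ∫⁻ y in rect x x', ‖mixedPartial R f y‖ₑ ^ q := by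
  rw [lintegral_subRect (fun y => ‖f y‖ₑ ^ q)]
  have hd : Disjoint Sᶜ S := disjoint_compl_left
  have := lmarginal_le_sum_lmarginal_union (x := x) (x' := x') hf hd
    fun i hi => hc i (Finset.mem_compl.1 hi)
  simp_rw [lintegral_rect (fun y => ‖mixedPartial _ f y‖ₑ ^ q) x.ofLp]
  rwa [Finset.union_comm, Finset.union_compl] at this

theorem exists_eLpNorm_extendBy_le {q : ℝ≥0∞} (hq : 1 ≤ q) (hq' : q ≠ ⊤)
    (hx : ∀ i, x i < x' i) (S : Finset (Fin n)) :
    ∃ K : ℝ≥0∞, K ≠ ⊤ ∧ ∀ f : EuclideanSpace ℝ (Fin n) → ℝ, ContDiff ℝ ∞ f →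
      eLpNorm (fun η => f (extendBy x S η)) q (volume.restrict (subRect x x' S)) ≤
        K * ∑ R ∈ Sᶜ.powerset, eLpNorm (mixedPartial R f) q (volume.restrict (rect x x')) := by
  have hq0 : q ≠ 0 := (zero_lt_one.trans_le hq).ne'
  have hq1 : 1 ≤ q.toReal := by
    rw [← ENNReal.toReal_one]; exact ENNReal.toReal_mono hq' hq
  have hqp : 0 < q.toReal := by linarith
  choose c hct hc using fun i => exists_endpointBound (hx i) hq1
  -- The sum of the side constants serves all coordinates at once.
  have hcb : ∀ i, EndpointBound q.toReal (∑ j, c j) (x i) (x' i) := fun i φ φ' h1 h2 =>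
    (hc i φ φ' h1 h2).trans (by
      gcongr; exact Finset.single_le_sum (f := c) (fun _ _ => zero_le) (Finset.mem_univ i))
  set M : ℝ≥0∞ := (∑ j, c j) ^ Sᶜ.card * Sᶜ.powerset.card with hM
  have hMt : M ≠ ⊤ := ENNReal.mul_ne_top
    (ENNReal.pow_ne_top (ENNReal.sum_ne_top.2 fun i _ => hct i)) (by simp)
  refine ⟨M ^ (1 / q.toReal), ENNReal.rpow_ne_top_of_nonneg (by positivity) hMt, fun f hf => ?_⟩
  set A := ∑ R ∈ Sᶜ.powerset, eLpNorm (mixedPartial R f) q (volume.restrict (rect x x')) with hA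
  have hR : ∀ R ∈ Sᶜ.powerset, ∫⁻ y in rect x x', ‖mixedPartial R f y‖ₑ ^ q.toReal ≤
      A ^ q.toReal := fun R hR => by
    have h1 : eLpNorm (mixedPartial R f) q (volume.restrict (rect x x')) ≤ A :=
      Finset.single_le_sum (f := fun R => eLpNorm (mixedPartial R f) q
        (volume.restrict (rect x x'))) (fun _ _ => zero_le) hR
    rw [eLpNorm_eq_lintegral_rpow_enorm_toReal hq0 hq'] at h1
    have h2 := ENNReal.rpow_le_rpow h1 hqp.le
    rwa [← ENNReal.rpow_mul, one_div, inv_mul_cancel₀ hqp.ne', ENNReal.rpow_one] at h2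
  rw [eLpNorm_eq_lintegral_rpow_enorm_toReal hq0 hq']
  calc _ ≤ ((∑ j, c j) ^ Sᶜ.card * ∑ R ∈ Sᶜ.powerset, ∫⁻ y in rect x x',
          ‖mixedPartial R f y‖ₑ ^ q.toReal) ^ (1 / q.toReal) := by
        gcongr
        exact lintegral_subRect_le hf fun i _ => hcb i
    _ ≤ (M * A ^ q.toReal) ^ (1 / q.toReal) := by
        rw [hM, mul_assoc]
        gcongr
        exact (Finset.sum_le_sum hR).trans_eq (by simp)
    _ = _ := by
        rw [ENNReal.mul_rpow_of_nonneg _ _ (by positivity), ← ENNReal.rpow_mul, one_div,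
          mul_inv_cancel₀ hqp.ne', ENNReal.rpow_one]

lemma integral_subRect_insert {F : EuclideanSpace ℝ (Fin n) → ℝ} (hF : Continuous F)
    (hi : i ∉ T) (z : EuclideanSpace ℝ (Fin n)) :
    ∫ η in subRect x x' (insert i T), F (extendBy z (insert i T) η) =
      ∫ η in subRect x x' T, ∫ t in Icc (x i) (x' i),
        F (WithLp.toLp 2 (Function.update (extendBy z T η).ofLp i t)) := by
  have hd : Disjoint T {i} := Finset.disjoint_singleton_right.2 hi
  have hins : insert i T = T ∪ {i} := by rw [Finset.union_comm, Finset.insert_eq]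
  rw [hins]
  have hint : Integrable (fun η => F (extendBy z (T ∪ {i}) η))
      (Measure.pi fun j : ↥(T ∪ {i}) => sideMeasure x x' j) := by
    rw [← volume_restrict_subRect]
    exact (hF.comp continuous_extendBy).continuousOn.integrableOn_compact isCompact_subRect
  have hmp := measurePreserving_piFinsetUnion hd (sideMeasure x x')
  have hint' := (hmp.integrable_comp_emb
    (MeasurableEquiv.measurableEmbedding _)).2 hint
  rw [volume_restrict_subRect, volume_restrict_subRect, ← hmp.integral_comp']
  refine (integral_prod _ hint').trans ?_
  refine integral_congr_ae (Eventually.of_forall fun η => ?_)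
  -- Identifies functions on the one-point index set `{i}` with real numbers.
  have hu := (measurePreserving_piUnique (fun j : ({i} : Finset (Fin n)) => sideMeasure x x' j)).symm
  beta_reduce
  rw [← hu.integral_comp']
  refine integral_congr_ae (Eventually.of_forall fun t => ?_)
  refine congrArg F (congrArg (WithLp.toLp 2) ?_)
  rw [Function.update_eq_updateFinset, extendBy_eq_toLp, Function.updateFinset_updateFinset hd]
  rfl

lemma integral_subRect_insert_partialDeriv (hf : ContDiff ℝ ∞ f) (hi : i ∉ T)
    (hx : x i ≤ x' i) {z : EuclideanSpace ℝ (Fin n)} (hz : z i = x i) :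
    ∫ η in subRect x x' (insert i T), partialDeriv i f (extendBy z (insert i T) η) =
      (∫ η in subRect x x' T,
        f (extendBy (WithLp.toLp 2 (Function.update z.ofLp i (x' i))) T η)) -
      ∫ η in subRect x x' T, f (extendBy z T η) := by
  have hf' := (contDiff_partialDeriv hf i).continuous
  have hI : ∀ w : EuclideanSpace ℝ (Fin n),
      IntegrableOn (fun η => f (extendBy w T η)) (subRect x x' T) := fun w =>
    (hf.continuous.comp continuous_extendBy).continuousOn.integrableOn_compact isCompact_subRect
  rw [integral_subRect_insert hf' hi, ← integral_sub (hI _) (hI _)]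
  refine integral_congr_ae (Eventually.of_forall fun η => ?_)
  beta_reduce
  set y := (extendBy z T η).ofLp with hy
  rw [integral_Icc_eq_integral_Ioc, ← intervalIntegral.integral_of_le hx,
    intervalIntegral.integral_eq_sub_of_hasDerivAt
      (fun t _ => hasDerivAt_toLp_update hf y i t)
      ((hf'.comp (continuous_toLp_update y i)).intervalIntegrable _ _)]
  have hyi : y i = x i := by simp [hy, extendBy, hi, hz]
  congr 2
  · ext j
    by_cases hj : j = i
    · subst hj; simp [extendBy, hi]
    · simp [hy, extendBy, hj]
  · rw [← hyi, Function.update_eq_self, hy]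

/-- Move coordinate `i` of the base point from `x i` to `x' i`. Each face integral over `T` then
changes by the integral of one more derivative over `insert i T`. The base point `z` is arbitrary
off `S` because the induction hypothesis is used at the moved point. -/
theorem newton_leibniz_sum_powerset (hf : ContDiff ℝ ∞ f) (S : Finset (Fin n))
    (hx : ∀ i ∈ S, x i ≤ x' i) (z : EuclideanSpace ℝ (Fin n)) (hz : ∀ i ∈ S, z i = x i) :
    f (extendBy z S fun i => x' i) =
      ∑ T ∈ S.powerset, ∫ η in subRect x x' T, mixedPartial T f (extendBy z T η) := by
  induction S using Finset.induction_on generalizing z with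
  | empty =>
    -- With no free coordinates the face is one point with unit mass.
    have : volume.restrict (subRect x x' ∅) = Measure.dirac fun _ => 0 := by
      rw [volume_restrict_subRect, Measure.pi_of_empty _ fun _ => 0]
    simp [this]
    congr 1
  | insert i S hi ih =>
    set z' : EuclideanSpace ℝ (Fin n) := WithLp.toLp 2 (Function.update z.ofLp i (x' i)) with hz'
    have h1 : extendBy z (insert i S) (fun i => x' i) = extendBy z' S fun i => x' i := by
      ext j
      by_cases hj : j = i
      · subst hj; simp [extendBy, hi, hz']
      · simp [extendBy, hz', hj]
    rw [h1, ih (fun j hj => hx j (Finset.mem_insert_of_mem hj)) z' fun j hj => ?_,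
      Finset.sum_powerset_insert hi, ← Finset.sum_add_distrib]
    · refine Finset.sum_congr rfl fun T hT => ?_
      have hiT : i ∉ T := fun h => hi (Finset.mem_powerset.1 hT h)
      rw [mixedPartial_insert hf hiT, integral_subRect_insert_partialDeriv
        (contDiff_mixedPartial hf T) hiT (hx i (Finset.mem_insert_self _ _))
        (hz i (Finset.mem_insert_self _ _)), add_sub_cancel]
    · have : j ≠ i := fun h => hi (h ▸ hj)
      simpa [hz', this] using hz j (Finset.mem_insert_of_mem hj)

theorem newton_leibniz (hf : ContDiff ℝ ∞ f) (hx : ∀ i, x i ≤ x' i) :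
    f x' - f x = ∑ S : Finset (Fin n) with S.Nonempty,
      ∫ η in subRect x x' S, mixedPartial S f (extendBy x S η) := by
  have h1 := newton_leibniz_sum_powerset hf Finset.univ (fun i _ => hx i) x fun _ _ => rfl
  -- The case `S = ∅` identifies the empty-set term of `h1` with `f x`.
  have h0 := newton_leibniz_sum_powerset (x' := x') hf ∅ (by simp) x fun _ _ => rfl
  have e1 : extendBy x Finset.univ (fun i => x' i) = x' := by ext; simp [extendBy]
  have e0 : extendBy x ∅ (fun i => x' i) = x := by ext; simp [extendBy]
  rw [e1, Finset.powerset_univ] at h1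
  rw [e0, Finset.powerset_empty, Finset.sum_singleton] at h0
  have hfil : (Finset.univ.filter fun S : Finset (Fin n) => S.Nonempty) = Finset.univ.erase ∅ := by
    ext S; simp [Finset.nonempty_iff_ne_empty]
  rw [h1, h0, hfil, ← Finset.add_sum_erase _ _ (Finset.mem_univ ∅), add_sub_cancel_left]

end Boxes

/-! ### Existence of traces on faces -/

section Traces

lemma exists_tendsto_eLpNorm_sub {α : Type*} [MeasurableSpace α] {μ : Measure α} {q : ℝ≥0∞}
    (hq : 1 ≤ q) {f : ℕ → α → ℝ} (hf : ∀ m, MemLp (f m) q μ)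
    (hc : Tendsto (fun k : ℕ × ℕ => eLpNorm (f k.1 - f k.2) q μ) atTop (𝓝 0)) :
    ∃ t, MemLp t q μ ∧ Tendsto (fun m => eLpNorm (f m - t) q μ) atTop (𝓝 0) := by
  have : Fact (1 ≤ q) := ⟨hq⟩
  have hcs : CauchySeq fun m => (hf m).toLp (f m) := by
    rw [Lp.cauchySeq_Lp_iff_cauchySeq_eLpNorm]
    refine hc.congr fun k => eLpNorm_congr_ae ?_
    exact ((hf k.1).coeFn_toLp.sub (hf k.2).coeFn_toLp).symm
  obtain ⟨L, hL⟩ := cauchySeq_tendsto_of_complete hcs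
  refine ⟨L, Lp.memLp L, ((Lp.tendsto_Lp_iff_tendsto_eLpNorm' _ _).1 hL).congr fun m => ?_⟩
  exact eLpNorm_congr_ae ((hf m).coeFn_toLp.sub EventuallyEq.rfl)

variable {n : ℕ} {p q : ℝ≥0∞} {S : Finset (Fin n)} {x x' : EuclideanSpace ℝ (Fin n)}
  {g : EuclideanSpace ℝ (Fin n) → ℝ} {f f' : ℕ → EuclideanSpace ℝ (Fin n) → ℝ}

lemma HasTransversalDerivs.locallyIntegrable (hg : HasTransversalDerivs p S g) :
    LocallyIntegrable g :=
  (hg ∅ (Finset.disjoint_empty_left _)).1.1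

lemma measurableSet_subRect : MeasurableSet (subRect x x' S) :=
  isCompact_subRect.isClosed.measurableSet

lemma measurableSet_rect : MeasurableSet (rect x x') :=
  isCompact_rect.isClosed.measurableSet

instance : IsFiniteMeasure (volume.restrict (subRect x x' S)) :=
  isFiniteMeasure_restrict.2 isCompact_subRect.measure_lt_top.ne

lemma memLp_comp_extendBy {f : EuclideanSpace ℝ (Fin n) → ℝ} (hf : Continuous f) (q : ℝ≥0∞) :
    MemLp (fun η => f (extendBy x S η)) q (volume.restrict (subRect x x' S)) := by
  have hc : Continuous fun η => f (extendBy x S η) := hf.comp continuous_extendBy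
  obtain ⟨C, hC⟩ := (isCompact_subRect (x := x) (x' := x') (S := S)).exists_bound_of_continuousOn
    hc.continuousOn
  exact MemLp.of_bound hc.aestronglyMeasurable C
    ((ae_restrict_mem measurableSet_subRect).mono hC)

lemma transversalApprox_mollify (hg : HasTransversalDerivs p S g) (hq : 1 ≤ q) (hqp : q ≤ p)
    (hq' : q ≠ ⊤) (x x' : EuclideanSpace ℝ (Fin n)) :
    TransversalApprox q S x x' (fun m => mollify (shrinkingBump n m) g) g := by
  refine ⟨fun m => contDiff_mollify hg.locallyIntegrable, fun R hR => ?_⟩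
  simp_rw [mixedPartial_mollify (hg R hR).1]
  exact tendsto_eLpNorm_mollify_sub_of_isBounded hq hqp hq' (tendsto_rOut_shrinkingBump n)
    (hg R hR).2 isCompact_rect.isBounded measurableSet_rect

/-- Apply the face estimate to the difference. The index maps `a`, `b` cover two uses: the Cauchy
property of one sequence, and the comparison of two sequences. -/
lemma TransversalApprox.tendsto_eLpNorm_sub {ι : Type*} {l : Filter ι} {a b : ι → ℕ}
    (hg : HasTransversalDerivs p S g) (hq : 1 ≤ q) (hq' : q ≠ ⊤) (hx : ∀ i, x i < x' i)
    (hf : TransversalApprox q S x x' f g) (hf' : TransversalApprox q S x x' f' g)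
    (ha : Tendsto a l atTop) (hb : Tendsto b l atTop) :
    Tendsto (fun j => eLpNorm (fun η => f (a j) (extendBy x S η) - f' (b j) (extendBy x S η)) q
      (volume.restrict (subRect x x' S))) l (𝓝 0) := by
  obtain ⟨K, hK, hKf⟩ := exists_eLpNorm_extendBy_le hq hq' hx S
  set ν := volume.restrict (rect x x') with hν
  have hlim : Tendsto (fun j => K * ∑ R ∈ Sᶜ.powerset,
      (eLpNorm (mixedPartial R (f (a j)) - weakDeriv R g) q ν +
        eLpNorm (mixedPartial R (f' (b j)) - weakDeriv R g) q ν)) l (𝓝 0) := by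
    have h0 : K * ∑ R ∈ Sᶜ.powerset, ((0 : ℝ≥0∞) + 0) = 0 := by simp
    rw [← h0]
    refine ENNReal.Tendsto.const_mul (tendsto_finsetSum _ fun R hR => ?_) (Or.inr hK)
    have hd : Disjoint R S :=
      Finset.disjoint_left.2 fun i hi => Finset.mem_compl.1 (Finset.mem_powerset.1 hR hi)
    exact ((hf.2 R hd).comp ha).add ((hf'.2 R hd).comp hb)
  refine tendsto_of_tendsto_of_tendsto_of_le_of_le tendsto_const_nhds hlim (fun _ => zero_le)
    fun j => ?_
  have hs : ContDiff ℝ ∞ (f (a j) - f' (b j)) := (hf.1 _).sub (hf'.1 _)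
  refine (hKf _ hs).trans ?_
  gcongr with R hR
  have hd : Disjoint R S :=
    Finset.disjoint_left.2 fun i hi => Finset.mem_compl.1 (Finset.mem_powerset.1 hR hi)
  have hw : AEStronglyMeasurable (weakDeriv R g) ν := (hg R hd).2.1.restrict
  have hsplit : mixedPartial R (f (a j) - f' (b j)) =
      (mixedPartial R (f (a j)) - weakDeriv R g) - (mixedPartial R (f' (b j)) - weakDeriv R g) := by
    rw [mixedPartial_sub (hf.1 _) (hf'.1 _)]; abel
  rw [hsplit]
  exact eLpNorm_sub_le
    ((contDiff_mixedPartial (hf.1 _) R).continuous.aestronglyMeasurable.sub hw)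
    ((contDiff_mixedPartial (hf'.1 _) R).continuous.aestronglyMeasurable.sub hw) hq

/-- Restriction to the sub-rectangle with free coordinates in `S` of the `m`-th mollification. -/
noncomputable def mollifiedTrace {n : ℕ} (S : Finset (Fin n)) (x : EuclideanSpace ℝ (Fin n))
    (g : EuclideanSpace ℝ (Fin n) → ℝ) (m : ℕ) (η : S → ℝ) : ℝ :=
  mollify (shrinkingBump n m) g (extendBy x S η)

lemma HasTransversalDerivs.memLp_mollifiedTrace (hg : HasTransversalDerivs p S g) (m : ℕ)
    (q : ℝ≥0∞) :
    MemLp (mollifiedTrace S x g m) q (volume.restrict (subRect x x' S)) :=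
  memLp_comp_extendBy (contDiff_mollify hg.locallyIntegrable).continuous q

lemma HasTransversalDerivs.exists_tendsto_mollifiedTrace (hg : HasTransversalDerivs p S g)
    (hx : ∀ i, x i < x' i) (h1 : 1 ≤ q) (h2 : q ≤ p) (h3 : q ≠ ⊤) :
    ∃ t, MemLp t q (volume.restrict (subRect x x' S)) ∧
      Tendsto (fun m => eLpNorm (mollifiedTrace S x g m - t) q
        (volume.restrict (subRect x x' S))) atTop (𝓝 0) := by
  have hT := transversalApprox_mollify hg h1 h2 h3 x x'
  refine exists_tendsto_eLpNorm_sub h1 (fun m => hg.memLp_mollifiedTrace m q) ?_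
  have hc := hT.tendsto_eLpNorm_sub (l := atTop ×ˢ atTop) (a := Prod.fst) (b := Prod.snd) hg h1 h3
    hx hT tendsto_fst tendsto_snd
  rw [prod_atTop_atTop_eq] at hc
  exact hc

/-- The mollifications have an `L_q` limit on the face for each finite `q ≤ p`. All these limits
agree with the one for `q = 1`, since each is a limit in measure. -/
theorem HasTransversalDerivs.exists_isTrace (hp : 1 ≤ p) (hg : HasTransversalDerivs p S g)
    (hx : ∀ i, x i < x' i) : ∃ t, IsTrace p S x x' g t := by
  obtain ⟨t, ht, htF⟩ := hg.exists_tendsto_mollifiedTrace hx le_rfl hp ENNReal.one_ne_top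
  have hmeas := tendstoInMeasure_of_tendsto_eLpNorm one_ne_zero
    (fun m => (hg.memLp_mollifiedTrace m 1).1) ht.1 htF
  have key : ∀ q : ℝ≥0∞, 1 ≤ q → q ≤ p → q ≠ ⊤ →
      MemLp t q (volume.restrict (subRect x x' S)) ∧
        Tendsto (fun m => eLpNorm (mollifiedTrace S x g m - t) q
          (volume.restrict (subRect x x' S))) atTop (𝓝 0) := fun q h1 h2 h3 => by
    obtain ⟨s, hs, hsF⟩ := hg.exists_tendsto_mollifiedTrace hx h1 h2 h3
    have hst : s =ᵐ[volume.restrict (subRect x x' S)] t := tendstoInMeasure_ae_unique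
      (tendstoInMeasure_of_tendsto_eLpNorm (zero_lt_one.trans_le h1).ne'
        (fun m => (hg.memLp_mollifiedTrace m q).1) hs.1 hsF) hmeas
    refine ⟨(memLp_congr_ae hst).1 hs, hsF.congr fun m => eLpNorm_congr_ae ?_⟩
    exact EventuallyEq.rfl.sub hst
  refine ⟨t, ?_, fun q h1 h2 h3 => ⟨⟨_, transversalApprox_mollify hg h1 h2 h3 x x'⟩,
    fun f hf => ?_⟩⟩
  -- For `p = ∞` there is no convergence in `L_∞`; instead the bound of the mollifications by the
  -- `L_∞` norm of `g` passes to `t` along an almost everywhere convergent subsequence.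
  · by_cases hp' : p = ⊤
    · subst hp'
      have hw := hg ∅ (Finset.disjoint_empty_left _)
      have hgp : MemLp g ⊤ := (memLp_congr_ae
        (hasWeakMixedDeriv_empty hg.locallyIntegrable).weakDeriv_ae_eq).1 hw.2
      obtain ⟨ns, -, hns⟩ := hmeas.exists_seq_tendsto_ae
      refine memLp_top_of_bound ht.1 (eLpNorm g ⊤ volume).toReal ?_
      filter_upwards [hns] with η hη
      refine le_of_tendsto' hη.norm fun k => ?_
      rw [← toReal_enorm]
      exact ENNReal.toReal_mono hgp.eLpNorm_ne_top (enorm_mollify_le_eLpNorm_top _)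
    · exact (key p hp le_rfl hp').1
  -- Any other approximating sequence is compared with the mollifications.
  · have h4 := hf.tendsto_eLpNorm_sub hg h1 h3 hx (transversalApprox_mollify hg h1 h2 h3 x x')
      tendsto_id tendsto_id
    have h5 := h4.add (key q h1 h2 h3).2
    rw [add_zero] at h5
    refine tendsto_of_tendsto_of_tendsto_of_le_of_le tendsto_const_nhds h5 (fun _ => zero_le)
      fun m => ?_
    have m1 : MemLp (fun η => f m (extendBy x S η)) q (volume.restrict (subRect x x' S)) :=
      memLp_comp_extendBy (hf.1 m).continuous q
    have hsplit : (fun η => f m (extendBy x S η) - t η) =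
        ((fun η => f m (extendBy x S η)) - mollifiedTrace S x g m) +
          (mollifiedTrace S x g m - t) := by
      funext η; simp
    beta_reduce
    rw [hsplit]
    exact eLpNorm_add_le (m1.sub (hg.memLp_mollifiedTrace m q)).1
      ((hg.memLp_mollifiedTrace m 1).1.sub ht.1) h1

lemma IsTrace.tendsto_integral_mollify {t : (S → ℝ) → ℝ} (hp : 1 ≤ p)
    (hg : HasTransversalDerivs p S g) (ht : IsTrace p S x x' g t) :
    Tendsto (fun m => ∫ η in subRect x x' S, mollify (shrinkingBump n m) g (extendBy x S η)) atTop
      (𝓝 (∫ η in subRect x x' S, t η)) := by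
  refine tendsto_integral_of_L1' t ?_ (Eventually.of_forall fun m => ?_)
    ((ht.2 1 le_rfl hp ENNReal.one_ne_top).2 _
      (transversalApprox_mollify hg le_rfl hp ENNReal.one_ne_top x x'))
  · exact ht.1.1
  · exact memLp_one_iff_integrable.1
      (memLp_comp_extendBy (contDiff_mollify hg.locallyIntegrable).continuous 1)

end Traces

/-! ### The continuous representative and its Hölder bound -/

section Embedding

open Set (Icc)

variable {n : ℕ} {p : ℝ≥0∞} {f u : EuclideanSpace ℝ (Fin n) → ℝ}

/-- The point of `ℝⁿ` with coordinates `x j + c j`. -/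
noncomputable def shiftCorner {n : ℕ} (x : EuclideanSpace ℝ (Fin n)) (c : Fin n → ℝ) :
    EuclideanSpace ℝ (Fin n) :=
  WithLp.toLp 2 fun j => x j + c j

lemma volume_rect_shiftCorner (x : EuclideanSpace ℝ (Fin n)) (c : Fin n → ℝ) :
    volume (rect x (shiftCorner x c)) = ∏ j, ENNReal.ofReal (c j) := by
  have h := lintegral_rect (x := x) (x' := shiftCorner x c) (fun _ => 1) x.ofLp
  rw [lmarginal_univ] at h
  simp only [lintegral_const, one_mul, Measure.restrict_apply_univ, Measure.pi_univ] at h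
  rw [h]
  simp [sideMeasure, shiftCorner]

lemma enorm_le_sum_eLpNorm_mixedPartial (hf : ContDiff ℝ ∞ f) (x : EuclideanSpace ℝ (Fin n)) :
    ‖f x‖ₑ ≤ ∑ R : Finset (Fin n),
      eLpNorm (mixedPartial R f) 1 (volume.restrict (rect x (shiftCorner x fun _ => 1))) := by
  have h := lintegral_subRect_le (x := x) (x' := shiftCorner x fun _ => 1) (S := ∅) (q := 1) (c := 1)
    hf fun i _ => endpointBound_one (by simp [shiftCorner])
  rw [lintegral_subRect (fun y => ‖f y‖ₑ ^ (1 : ℝ)), lmarginal_empty] at h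
  simpa [eLpNorm_one_eq_lintegral_enorm] using h

/-- The increment is at most the integral of `|∂f/∂x_i|` over a segment. That segment is the face `S
= {i}` of a box with all other sides `1`, so the face estimate applies to `∂f/∂x_i`. -/
lemma enorm_update_sub_le_sum_eLpNorm_mixedPartial (hf : ContDiff ℝ ∞ f)
    (x : EuclideanSpace ℝ (Fin n)) (i : Fin n) {h : ℝ} (hh : 0 ≤ h) :
    ‖f (WithLp.toLp 2 (Function.update x.ofLp i (x i + h))) - f x‖ₑ ≤
      ∑ R ∈ ({i} : Finset (Fin n))ᶜ.powerset, eLpNorm (mixedPartial (insert i R) f) 1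
        (volume.restrict (rect x (shiftCorner x fun j => if j = i then h else 1))) := by
  set y := shiftCorner x fun j => if j = i then h else 1 with hy
  have hf' := contDiff_partialDeriv hf i
  have hyi : y i = x i + h := by simp [hy, shiftCorner]
  have h1 := enorm_sub_le_lintegral_enorm_deriv
    (hf'.continuous.comp (continuous_toLp_update x.ofLp i)) (hasDerivAt_toLp_update hf x.ofLp i)
    (a := x i) (b := y i) (t := x i + h) ⟨by linarith, hyi.ge⟩
  have h2 := lintegral_subRect_le (x := x) (x' := y) (S := {i}) (q := 1) (c := 1)
    hf' fun j hj => endpointBound_one (by simp [hy, shiftCorner, Finset.notMem_singleton.1 hj])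
  rw [lintegral_subRect (fun y => ‖partialDeriv i f y‖ₑ ^ (1 : ℝ)), lmarginal_singleton] at h2
  rw [Function.update_eq_self] at h1
  refine h1.trans ?_
  simp only [ENNReal.rpow_one, one_pow, one_mul] at h2
  refine h2.trans (Finset.sum_le_sum fun R hR => ?_)
  have hiR : i ∉ R := fun h => by simpa using Finset.mem_powerset.1 hR h
  have hcomm : mixedPartial (insert i R) f = mixedPartial R (partialDeriv i f) := by
    rw [← mixedPartial_singleton hf, mixedPartial_mixedPartial hf (by simpa using hiR),
      Finset.union_comm, Finset.insert_eq]
  rw [hcomm, eLpNorm_one_eq_lintegral_enorm]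

lemma MemSobolevS.eLpNorm_weakDeriv_le (hp : 1 ≤ p) (hu : MemSobolevS p u) (R : Finset (Fin n)) :
    eLpNorm (weakDeriv R u) p volume ≤ sobolevSNorm p u := by
  have hs : ∀ (F : Finset (Fin n) → ℝ≥0∞) {R : Finset (Fin n)}, R.Nonempty →
      F R ≤ ∑ S : Finset (Fin n) with S.Nonempty, F S := fun F R hR =>
    Finset.single_le_sum (f := F) (fun _ _ => zero_le) (by simpa using hR)
  have hempty : eLpNorm (weakDeriv ∅ u) p volume = eLpNorm u p volume :=
    eLpNorm_congr_ae (hu.weakDeriv_empty_ae_eq hp)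
  unfold sobolevSNorm
  split_ifs with h
  · subst h
    rcases R.eq_empty_or_nonempty with rfl | hR
    · rw [hempty]; exact le_self_add
    · exact (hs (fun S => eLpNorm (weakDeriv S u) ⊤ volume) hR).trans le_add_self
  · have hpos : 0 < p.toReal := ENNReal.toReal_pos (zero_lt_one.trans_le hp).ne' h
    have hle : eLpNorm (weakDeriv R u) p volume ^ p.toReal ≤ eLpNorm u p volume ^ p.toReal +
        ∑ S : Finset (Fin n) with S.Nonempty, eLpNorm (weakDeriv S u) p volume ^ p.toReal := by
      rcases R.eq_empty_or_nonempty with rfl | hR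
      · rw [hempty]; exact le_self_add
      · exact (hs (fun S => eLpNorm (weakDeriv S u) p volume ^ p.toReal) hR).trans le_add_self
    calc _ = (eLpNorm (weakDeriv R u) p volume ^ p.toReal) ^ (1 / p.toReal) := by
          rw [← ENNReal.rpow_mul, mul_one_div_cancel hpos.ne', ENNReal.rpow_one]
      _ ≤ _ := by gcongr

lemma MemSobolevS.sobolevSNorm_ne_top (hp : 1 ≤ p) (hu : MemSobolevS p u) :
    sobolevSNorm p u ≠ ⊤ := by
  have hw : ∀ S : Finset (Fin n), eLpNorm (weakDeriv S u) p volume ≠ ⊤ := fun S =>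
    (hu.hasWeakMixedDeriv hp S).2.eLpNorm_ne_top
  unfold sobolevSNorm
  split_ifs with h
  · subst h
    exact ENNReal.add_ne_top.2 ⟨hu.1.eLpNorm_ne_top, ENNReal.sum_ne_top.2 fun S _ => hw S⟩
  · exact ENNReal.rpow_ne_top_of_nonneg (by positivity) (ENNReal.add_ne_top.2
      ⟨ENNReal.rpow_ne_top_of_nonneg (by positivity) hu.1.eLpNorm_ne_top,
        ENNReal.sum_ne_top.2 fun S _ => ENNReal.rpow_ne_top_of_nonneg (by positivity) (hw S)⟩)

/-- For `p = ∞` both sides are `1`, since `p.toReal = 0` and `1 / 0 = 0`. -/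
lemma holderExponent_eq (hp : 1 ≤ p) : ((1 - p⁻¹).toNNReal : ℝ) = 1 - 1 / p.toReal := by
  rw [ENNReal.coe_toNNReal_eq_toReal, ENNReal.toReal_sub_of_le (ENNReal.inv_le_one.2 hp)
    ENNReal.one_ne_top, ENNReal.toReal_inv, ENNReal.toReal_one, one_div]

lemma MemSobolevS.eLpNorm_one_restrict_weakDeriv_le (hp : 1 ≤ p) (hu : MemSobolevS p u)
    (R : Finset (Fin n)) (s : Set (EuclideanSpace ℝ (Fin n))) :
    eLpNorm (weakDeriv R u) 1 (volume.restrict s) ≤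
      sobolevSNorm p u * volume s ^ ((1 - p⁻¹).toNNReal : ℝ) := by
  have h := eLpNorm_le_eLpNorm_mul_rpow_measure_univ hp
    (hu.hasWeakMixedDeriv hp R).2.1.restrict (μ := volume.restrict s)
  rw [Measure.restrict_apply_univ, ENNReal.toReal_one, div_one] at h
  rw [holderExponent_eq hp]
  refine h.trans ?_
  gcongr
  exact (eLpNorm_mono_measure _ Measure.restrict_le_self).trans (hu.eLpNorm_weakDeriv_le hp R)

lemma MemSobolevS.locallyIntegrable (hp : 1 ≤ p) (hu : MemSobolevS p u) : LocallyIntegrable u :=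
  hu.1.locallyIntegrable hp

lemma MemSobolevS.mixedPartial_mollify (hp : 1 ≤ p) (hu : MemSobolevS p u)
    (φ : ContDiffBump (0 : EuclideanSpace ℝ (Fin n))) (R : Finset (Fin n)) :
    mixedPartial R (mollify φ u) = mollify φ (weakDeriv R u) :=
  _root_.mixedPartial_mollify (hu.hasWeakMixedDeriv hp R).1

lemma MemSobolevS.tendsto_eLpNorm_mixedPartial_mollify_sub (hp : 1 ≤ p) (hu : MemSobolevS p u)
    (R : Finset (Fin n)) (x x' : EuclideanSpace ℝ (Fin n)) :
    Tendsto (fun m => eLpNorm (mixedPartial R (mollify (shrinkingBump n m) u) - weakDeriv R u) 1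
      (volume.restrict (rect x x'))) atTop (𝓝 0) := by
  simp_rw [hu.mixedPartial_mollify hp]
  exact tendsto_eLpNorm_mollify_sub_of_isBounded le_rfl hp ENNReal.one_ne_top
    (tendsto_rOut_shrinkingBump n) (hu.hasWeakMixedDeriv hp R).2 isCompact_rect.isBounded
    measurableSet_rect

/-- Transfers the estimates for smooth functions to the limit, by `L_1` convergence of the
derivatives on the box. -/
lemma MemSobolevS.enorm_le_of_tendsto {ι : Type*} (hp : 1 ≤ p) (hu : MemSobolevS p u) {a : ℕ → ℝ}
    {b : ℝ} (hab : Tendsto a atTop (𝓝 b)) {x x' : EuclideanSpace ℝ (Fin n)} {s : Finset ι}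
    {I : ι → Finset (Fin n)}
    (h : ∀ m, ‖a m‖ₑ ≤ ∑ R ∈ s, eLpNorm (mixedPartial (I R) (mollify (shrinkingBump n m) u)) 1
      (volume.restrict (rect x x'))) :
    ‖b‖ₑ ≤ ∑ R ∈ s, eLpNorm (weakDeriv (I R) u) 1 (volume.restrict (rect x x')) := by
  have hlim : Tendsto (fun m => ∑ R ∈ s,
      (eLpNorm (mixedPartial (I R) (mollify (shrinkingBump n m) u) - weakDeriv (I R) u) 1
        (volume.restrict (rect x x')) + eLpNorm (weakDeriv (I R) u) 1
        (volume.restrict (rect x x')))) atTop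
      (𝓝 (∑ R ∈ s, (0 + eLpNorm (weakDeriv (I R) u) 1 (volume.restrict (rect x x'))))) :=
    tendsto_finsetSum _ fun R _ =>
      (hu.tendsto_eLpNorm_mixedPartial_mollify_sub hp (I R) x x').add_const _
  simp only [zero_add] at hlim
  refine le_of_tendsto_of_tendsto' hab.enorm hlim fun m => (h m).trans ?_
  gcongr with R hR
  have hw : AEStronglyMeasurable (weakDeriv (I R) u) (volume.restrict (rect x x')) :=
    (hu.hasWeakMixedDeriv hp (I R)).2.1.restrict
  have hc := (contDiff_mixedPartial (contDiff_mollify (φ := shrinkingBump n m)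
    (hu.locallyIntegrable hp)) (I R)).continuous.aestronglyMeasurable
    (μ := volume.restrict (rect x x'))
  simpa using eLpNorm_add_le (hc.sub hw) hw le_rfl

lemma rect_shiftCorner_mem_nhds (x : EuclideanSpace ℝ (Fin n)) :
    rect (shiftCorner x fun _ => -1) (shiftCorner x fun _ => 1) ∈ 𝓝 x := by
  rw [rect_eq_preimage]
  refine (PiLp.continuous_ofLp 2 _).continuousAt.preimage_mem_nhds
    (set_pi_mem_nhds Set.finite_univ fun i _ => Icc_mem_nhds ?_ ?_) <;> simp [shiftCorner]

lemma MemSobolevS.uniformCauchySeqOn_mollify (hp : 1 ≤ p) (hu : MemSobolevS p u)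
    (x : EuclideanSpace ℝ (Fin n)) :
    UniformCauchySeqOn (fun m => mollify (shrinkingBump n m) u) atTop
      (rect (shiftCorner x fun _ => -1) (shiftCorner x fun _ => 1)) := by
  -- Unit boxes with bottom corner in the cube from `x - 1` to `x + 1` reach up to `x + 2`.
  set B := rect (shiftCorner x fun _ => -1) (shiftCorner x fun _ => 2) with hB
  set E : ℕ → ℝ≥0∞ := fun m => ∑ R : Finset (Fin n),
    eLpNorm (mixedPartial R (mollify (shrinkingBump n m) u) - weakDeriv R u) 1
      (volume.restrict B) with hE
  have hE0 : Tendsto E atTop (𝓝 0) := by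
    have := tendsto_finsetSum (Finset.univ : Finset (Finset (Fin n))) fun R _ =>
      hu.tendsto_eLpNorm_mixedPartial_mollify_sub hp R (shiftCorner x fun _ => -1)
        (shiftCorner x fun _ => 2)
    simpa using this
  have hE2 : Tendsto (fun k : ℕ × ℕ => E k.1 + E k.2) (atTop ×ˢ atTop) (𝓝 0) := by
    simpa using (hE0.comp tendsto_fst).add (hE0.comp tendsto_snd)
  have hsm : ∀ m, ContDiff ℝ ∞ (mollify (shrinkingBump n m) u) := fun m =>
    contDiff_mollify (hu.locallyIntegrable hp)
  have hbound : ∀ (k : ℕ × ℕ), ∀ y ∈ rect (shiftCorner x fun _ => -1) (shiftCorner x fun _ => 1),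
      edist (mollify (shrinkingBump n k.1) u y) (mollify (shrinkingBump n k.2) u y) ≤
        E k.1 + E k.2 := fun k y hy => by
    rw [edist_eq_enorm_sub]
    have hd : ContDiff ℝ ∞ (mollify (shrinkingBump n k.1) u - mollify (shrinkingBump n k.2) u) :=
      (hsm k.1).sub (hsm k.2)
    refine (enorm_le_sum_eLpNorm_mixedPartial hd y).trans ?_
    rw [hE, ← Finset.sum_add_distrib]
    refine Finset.sum_le_sum fun R _ => ?_
    have hsub : rect y (shiftCorner y fun _ => 1) ⊆ B := fun z hz i => by
      have h1 := hy i
      have h2 := hz i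
      simp only [shiftCorner] at h1 h2 ⊢
      constructor <;> linarith [h1.1, h1.2, h2.1, h2.2]
    have hw : AEStronglyMeasurable (weakDeriv R u) (volume.restrict B) :=
      (hu.hasWeakMixedDeriv hp R).2.1.restrict
    have hc : ∀ m, AEStronglyMeasurable (mixedPartial R (mollify (shrinkingBump n m) u))
        (volume.restrict B) := fun m =>
      (contDiff_mixedPartial (hsm m) R).continuous.aestronglyMeasurable
    have hsplit : mixedPartial R
        (mollify (shrinkingBump n k.1) u - mollify (shrinkingBump n k.2) u) =
        (mixedPartial R (mollify (shrinkingBump n k.1) u) - weakDeriv R u) -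
          (mixedPartial R (mollify (shrinkingBump n k.2) u) - weakDeriv R u) := by
      rw [mixedPartial_sub (hsm _) (hsm _)]; abel
    rw [hsplit]
    exact (eLpNorm_mono_measure _ (Measure.restrict_mono hsub le_rfl)).trans
      (eLpNorm_sub_le ((hc _).sub hw) ((hc _).sub hw) le_rfl)
  intro U hU
  obtain ⟨ε, hε, hεU⟩ := mem_uniformity_edist.1 hU
  filter_upwards [(tendsto_order.1 hE2).2 ε hε] with k hk y hy
  exact hεU ((hbound k y hy).trans_lt hk)

/-- The mollifications of `u ∈ S_p^1` converge pointwise to a continuous function. -/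
lemma MemSobolevS.exists_continuous_tendsto_mollify (hp : 1 ≤ p) (hu : MemSobolevS p u) :
    ∃ v : EuclideanSpace ℝ (Fin n) → ℝ, Continuous v ∧
      ∀ x, Tendsto (fun m => mollify (shrinkingBump n m) u x) atTop (𝓝 (v x)) := by
  have hpt : ∀ x, ∃ y, Tendsto (fun m => mollify (shrinkingBump n m) u x) atTop (𝓝 y) := fun x =>
    cauchySeq_tendsto_of_complete ((hu.uniformCauchySeqOn_mollify hp x).cauchySeq
      (mem_of_mem_nhds (rect_shiftCorner_mem_nhds x)))
  choose v hv using hpt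
  refine ⟨v, continuous_iff_continuousAt.2 fun x => ?_, hv⟩
  have hU := (hu.uniformCauchySeqOn_mollify hp x).tendstoUniformlyOn_of_tendsto fun y _ => hv y
  exact (hU.continuousOn (Frequently.of_forall fun m =>
    (contDiff_mollify (hu.locallyIntegrable hp)).continuous.continuousOn)).continuousAt
    (rect_shiftCorner_mem_nhds x)

variable {v : EuclideanSpace ℝ (Fin n) → ℝ}

lemma MemSobolevS.enorm_le_of_tendsto_mollify (hp : 1 ≤ p) (hu : MemSobolevS p u)
    (hv : ∀ x, Tendsto (fun m => mollify (shrinkingBump n m) u x) atTop (𝓝 (v x)))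
    (x : EuclideanSpace ℝ (Fin n)) : ‖v x‖ₑ ≤ 2 ^ n * sobolevSNorm p u := by
  refine (hu.enorm_le_of_tendsto hp (I := id) (hv x) fun m => enorm_le_sum_eLpNorm_mixedPartial
    (contDiff_mollify (hu.locallyIntegrable hp)) x).trans ?_
  refine (Finset.sum_le_card_nsmul _ _ (sobolevSNorm p u) fun R _ => ?_).trans_eq (by simp)
  simpa [volume_rect_shiftCorner] using hu.eLpNorm_one_restrict_weakDeriv_le hp R
    (rect x (shiftCorner x fun _ => 1))

lemma MemSobolevS.edist_update_le (hp : 1 ≤ p) (hu : MemSobolevS p u)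
    (hv : ∀ x, Tendsto (fun m => mollify (shrinkingBump n m) u x) atTop (𝓝 (v x)))
    (x : Fin n → ℝ) (i : Fin n) (t : ℝ) :
    edist (v (WithLp.toLp 2 (Function.update x i t))) (v (WithLp.toLp 2 x)) ≤
      2 ^ n * sobolevSNorm p u * edist t (x i) ^ ((1 - p⁻¹).toNNReal : ℝ) := by
  -- Otherwise exchange the two points: start from the updated point and restore `x i`.
  wlog hxt : x i ≤ t generalizing x t
  · have h := this (Function.update x i t) (x i) (by simpa using (not_le.1 hxt).le)
    simpa [edist_comm] using h
  have h := hu.enorm_le_of_tendsto hp (I := fun R => insert i R) ((hv _).sub (hv _)) fun m =>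
    enorm_update_sub_le_sum_eLpNorm_mixedPartial
      (contDiff_mollify (φ := shrinkingBump n m) (hu.locallyIntegrable hp)) (WithLp.toLp 2 x) i
      (sub_nonneg.2 hxt)
  simp only [add_sub_cancel] at h
  rw [edist_eq_enorm_sub]
  refine h.trans ?_
  refine (Finset.sum_le_card_nsmul _ _
    (sobolevSNorm p u * edist t (x i) ^ ((1 - p⁻¹).toNNReal : ℝ)) fun R _ => ?_).trans ?_
  · refine (hu.eLpNorm_one_restrict_weakDeriv_le hp _ _).trans_eq ?_
    -- All sides but the `i`-th have length `1`, so the volume is `t - x i`.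
    rw [volume_rect_shiftCorner, Finset.prod_eq_single i (fun j _ hj => by simp [hj]) (by simp)]
    rw [if_pos rfl, edist_dist, Real.dist_eq, abs_of_nonneg (sub_nonneg.2 hxt)]
  · rw [nsmul_eq_mul, mul_assoc]
    gcongr
    exact_mod_cast (Finset.card_le_univ _).trans_eq (by simp)

/-- Pass from `b` to `a` by changing one coordinate at a time: `n` steps, each of length at most the
Euclidean distance. -/
lemma MemSobolevS.edist_le (hp : 1 ≤ p) (hu : MemSobolevS p u)
    (hv : ∀ x, Tendsto (fun m => mollify (shrinkingBump n m) u x) atTop (𝓝 (v x)))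
    (a b : EuclideanSpace ℝ (Fin n)) :
    edist (v a) (v b) ≤
      n * 2 ^ n * sobolevSNorm p u * edist a b ^ ((1 - p⁻¹).toNNReal : ℝ) := by
  set K := 2 ^ n * sobolevSNorm p u * edist a b ^ ((1 - p⁻¹).toNNReal : ℝ) with hK
  have key : ∀ S : Finset (Fin n),
      edist (v (WithLp.toLp 2 (S.piecewise a.ofLp b.ofLp))) (v b) ≤ S.card * K := fun S => by
    induction S using Finset.induction_on with
    | empty => simp
    | insert i S hi ih =>
      rw [Finset.piecewise_insert, Finset.card_insert_of_notMem hi, Nat.cast_add, Nat.cast_one,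
        add_mul, one_mul, add_comm]
      refine (edist_triangle _ _ _).trans (add_le_add ?_ ih)
      refine (hu.edist_update_le hp hv _ i _).trans ?_
      rw [Finset.piecewise_eq_of_notMem _ _ _ hi, hK]
      gcongr
      exact PiLp.edist_apply_le a b i
  have h := key Finset.univ
  rw [Finset.piecewise_univ, Finset.card_univ, Fintype.card_fin] at h
  refine h.trans_eq ?_
  rw [hK]
  ring

lemma MemSobolevS.holderNorm_le (hp : 1 ≤ p) (hu : MemSobolevS p u)
    (hv : ∀ x, Tendsto (fun m => mollify (shrinkingBump n m) u x) atTop (𝓝 (v x))) :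
    holderNorm (1 - p⁻¹).toNNReal v ≤ ((n + 1) * 2 ^ n : ℝ≥0) * sobolevSNorm p u := by
  have hN := hu.sobolevSNorm_ne_top hp
  have hH : HolderWith (n * 2 ^ n * (sobolevSNorm p u).toNNReal) (1 - p⁻¹).toNNReal v :=
    fun a b => by
      push_cast
      rw [ENNReal.coe_toNNReal hN]
      exact hu.edist_le hp hv a b
  have h := add_le_add (iSup_le (hu.enorm_le_of_tendsto_mollify hp hv)) hH.eHolderNorm_le
  refine h.trans_eq ?_
  push_cast
  rw [ENNReal.coe_toNNReal hN]
  ring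

lemma MemSobolevS.sub_eq_sum_integral_trace (hp : 1 ≤ p) (hu : MemSobolevS p u)
    (hv : ∀ x, Tendsto (fun m => mollify (shrinkingBump n m) u x) atTop (𝓝 (v x)))
    {x x' : EuclideanSpace ℝ (Fin n)} (hx : ∀ i, x i < x' i)
    {t : (S : Finset (Fin n)) → (S → ℝ) → ℝ}
    (ht : ∀ S : Finset (Fin n), S.Nonempty → IsTrace p S x x' (weakDeriv S u) (t S)) :
    v x' - v x = ∑ S : Finset (Fin n) with S.Nonempty, ∫ η in subRect x x' S, t S η := by
  refine tendsto_nhds_unique ((hv x').sub (hv x)) ?_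
  simp_rw [fun m => newton_leibniz (contDiff_mollify (φ := shrinkingBump n m)
    (hu.locallyIntegrable hp)) fun i => (hx i).le, hu.mixedPartial_mollify hp]
  exact tendsto_finsetSum _ fun S hS =>
    (ht S (by simpa using hS)).tendsto_integral_mollify hp (hu.hasTransversalDerivs hp S)

end Embedding

theorem theorem2 (n : ℕ) (p : ℝ≥0∞) (hp : 1 ≤ p) :
    ∃ C : ℝ≥0, ∀ u : EuclideanSpace ℝ (Fin n) → ℝ, MemSobolevS p u →
      ∃ v : EuclideanSpace ℝ (Fin n) → ℝ,
        v =ᵐ[volume] u ∧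
        MemHolderSpace (1 - p⁻¹).toNNReal v ∧
        holderNorm (1 - p⁻¹).toNNReal v ≤ C * sobolevSNorm p u ∧
        ∀ x x' : EuclideanSpace ℝ (Fin n), (∀ i, x i < x' i) →
          ∃ t : (S : Finset (Fin n)) → (S → ℝ) → ℝ,
            (∀ S : Finset (Fin n), S.Nonempty → IsTrace p S x x' (weakDeriv S u) (t S)) ∧
            v x' - v x =
              ∑ S : Finset (Fin n) with S.Nonempty, ∫ η in subRect x x' S, t S η := by
  refine ⟨(n + 1) * 2 ^ n, fun u hu => ?_⟩
  obtain ⟨v, hvc, hv⟩ := hu.exists_continuous_tendsto_mollify hp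
  have hnorm := hu.holderNorm_le hp hv
  refine ⟨v, ?_, ⟨hvc, hnorm.trans_lt ?_⟩, hnorm, fun x x' hx => ?_⟩
  · filter_upwards [ae_tendsto_mollify_shrinkingBump (hu.locallyIntegrable hp)] with x hx
    exact tendsto_nhds_unique (hv x) hx
  · exact (ENNReal.mul_ne_top ENNReal.coe_ne_top (hu.sobolevSNorm_ne_top hp)).lt_top
  · choose t ht using fun S : Finset (Fin n) =>
      (hu.hasTransversalDerivs hp S).exists_isTrace hp hx
    exact ⟨t, fun S _ => ht S, hu.sub_eq_sum_integral_trace hp hv hx fun S _ => ht S⟩
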